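/- **Setting.** Let $k\ge 1$, let $M_k=\{e_1,\dots,e_k,f_1,\dots,f_k\}$ be a set of markers, and let $\mathcal M$ be a finite-state Markov chain with initial state $s_{in}$, transition probabilities $\mathbf P(s,s')$ and an observation $\mathrm{Obs}(s)\subseteq M_k$ for every state $s$. A run $s_0s_1s_2\cdots$ is *good* if for some $i$ it has $e_i\in \mathrm{Obs}(s_n)$ for infinitely many $n$ and $f_i\in\mathrm{Obs}(s_n)$ for only finitely many $n$. Let $P_{good}$ be the probability that the run of $\mathcal M$ from $s_{in}$ is good, and assume $P_{good}>0$. **Strategy.** The length of a finite path $s_0\cdots s_m$ is $m$, and its second half is $s_{\lceil m/2\rceil}\cdots s_m$. A finite path is good if it has length $0$ or if, for some $i$, one of its states is marked $e_i$ and none is marked $f_i$. The strategy $\mathfrak S[f]$ works in phases $n=1,2,3,\dots$; phase $n$ begins after the $(n-1)$-th restart (phase $1$ at the beginning), in state $s_{in}$. In phase $n$ the chain is sampled in blocks of $2f(n)$ steps; at the end of each block, the chain is restarted (it moves to $s_{in}$, and phase $n$ ends) if the second half of the path executed in this phase is not good, and otherwise sampling continues. Let $S$ be the number of steps executed up to and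 including the last restart: $S=0$ if there is no restart, and $S=\infty$ if there are infinitely many. **Progress radius and progress probability.** A bottom strongly connected component (BSCC) $B$ of the graph with edges $\{(s,s'):\mathbf P(s,s')>0\}$ is $i$-good if it has a state marked $e_i$ and no state marked $f_i$; it is good if it is $i$-good for some $i$, and bad otherwise. Let $B_\gamma$ (resp. $B_\beta$) be the set of states in good (resp. bad) BSCCs and $S_\gamma$ (resp. $S_\beta$) the set of states from which $B_\gamma$ (resp. $B_\beta$) can be reached. A path $\pi$ of positive length starting at $s$ is a *good progress path* if either $s\in S_\gamma\setminus B_\gamma$ and $\pi$ ends in $B_\gamma$, or $s$ lies in an $i$-good BSCC for some $i$ such that $\pi$ ends at a state marked $e_i$. It is a *bad progress path* if either $s\in S_\beta\setminus B_\beta$ and $\pi$ ends in $B_\beta$, or $s$ lies in a bad BSCC $B$ and, for every $i$ such that some state of $B$ is marked $e_i$, $\pi$ visits a state marked $f_i$. (Two conventions are possible for the last condition: the starting state of $\pi$ counts as visited, or it does not. The theorem holds for either.) Let $r_\gamma$ be the maximum over $s\in S_\gamma\setminus B_\gamma$ of the length of a shortest good progress path from $s$, and $p_\gamma$ the minimum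 over the same $s$ of the probability that the random path of length $r_\gamma$ starting at $s$ contains a good progress path. Let $R_\gamma$ and $P_\gamma$ be defined in the same way with $s$ ranging over $B_\gamma$, and $r_\beta,p_\beta$ and $R_\beta,P_\beta$ in the same way with bad progress paths and $S_\beta\setminus B_\beta$, $B_\beta$. The *progress radius* is $R_m=\max(r_\gamma,R_\gamma,r_\beta,R_\beta)$ and the *progress probability* is $P_m=\min(p_\gamma,P_\gamma,p_\beta,P_\beta)$, where quantities whose range of states is empty are left out. **Theorem.** There is an absolute constant $K$ such that for all integers $c\ge1$ and $k\ge 1$ and all finite-state Markov chains $\mathcal M$ with observations in $2^{M_k}$ and $P_{good}>0$, the strategy $\mathfrak S[n\mapsto n^c]$ satisfies $$\mathbb E[S]\;\le\; K\left((c+1)!\cdot 2^c\left(\frac{R_m}{P_m}\right)^{1+1/c}+\frac{2^c\,(c+1)!}{P_{good}^{\,c+1}}+(c+1)!\,(2c)^{c+1}\right).$$ -/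

import Mathlib

open MeasureTheory ProbabilityTheory
open scoped ENNReal Nat

/-- A partially observable Markov chain with states `S` and observations `O`.  The rows of the
transition matrix are probability mass functions.  Finiteness of `S` is required where chains are
quantified over (the chain induced by a strategy on a decision process has infinitely many states). -/
structure POMC (S O : Type*) where
  init : S
  obs : S → O
  step : S → PMF S

/-- A partially observable Markov decision process with actions `A`. -/
structure POMDP (S O A : Type*) where
  init : S
  obs : S → O
  step : S → A → PMF S

/-- A strategy `(O × A)* O → A`: it sees the past observations and actions, and the current
observation. -/
abbrev Strategy (O A : Type*) := List (O × A) → O → A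

/-- Elements of `(S × A)* × S`, the states of the chain induced by a strategy. -/
@[ext] structure History (S A : Type*) where
  past : List (S × A)
  last : S

instance {S A : Type*} : MeasurableSpace (History S A) := ⊤

instance {S A : Type*} : DiscreteMeasurableSpace (History S A) := ⟨fun _ => trivial⟩

instance {S A : Type*} [Countable S] [Countable A] : Countable (History S A) :=
  Function.Injective.countable (f := fun h : History S A => (h.past, h.last))
    (by
      intro a b hab
      simp only [Prod.mk.injEq] at hab
      exact History.ext hab.1 hab.2)

/-- The two actions of a restart process. -/
inductive RestartAction
  | restart
  | cont
  deriving DecidableEq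

instance : Countable RestartAction :=
  Function.Injective.countable (f := fun a : RestartAction => match a with | .restart => 0 | .cont => 1)
    (by intro a b; cases a <;> cases b <;> simp)

namespace POMDP

/-- The chain induced by a strategy on a decision process. -/
noncomputable def induced {S O A : Type*} (D : POMDP S O A) (σ : Strategy O A) :
    POMC (History S A) O where
  init := ⟨[], D.init⟩
  obs h := D.obs h.last
  step h :=
    let a := σ (h.past.map fun p => (D.obs p.1, p.2)) (D.obs h.last)
    (D.step h.last a).map fun s' => ⟨h.past ++ [(h.last, a)], s'⟩

end POMDP

namespace POMC

section General

variable {S O : Type*} (M : POMC S O)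

/-- The restart process: in every state one may go back to the initial state, or continue. -/
noncomputable def restartMDP : POMDP S O RestartAction where
  init := M.init
  obs := M.obs
  step s a := match a with
    | .restart => PMF.pure M.init
    | .cont => M.step s

/-- The next state, given the states visited at the times `0, …, n`. -/
noncomputable def stepKernel [Countable S] [MeasurableSpace S] [DiscreteMeasurableSpace S]
    (n : ℕ) : Kernel (Π _ : Finset.Iic n, S) S :=
  Kernel.comap ⟨fun s => (M.step s).toMeasure, .of_discrete⟩
    (fun h : (Π _ : Finset.Iic n, S) => h ⟨n, Finset.mem_Iic.2 le_rfl⟩) (measurable_pi_apply _)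

instance [Countable S] [MeasurableSpace S] [DiscreteMeasurableSpace S] (n : ℕ) :
    IsMarkovKernel (M.stepKernel n) :=
  ⟨fun h => by
    rw [stepKernel, Kernel.comap_apply]
    exact PMF.toMeasure.isProbabilityMeasure _⟩

/-- The law of the infinite run that starts in the state `s`. -/
noncomputable def runMeasure [Countable S] [MeasurableSpace S] [DiscreteMeasurableSpace S]
    (s : S) : Measure (ℕ → S) :=
  Kernel.traj (X := fun _ => S) M.stepKernel 0 (fun _ => s)

/-- The edges of the graph of the chain. -/
def Edge (s t : S) : Prop := 0 < M.step s t

def Reach : S → S → Prop := Relation.ReflTransGen M.Edge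

def StronglyConnected (B : Set S) : Prop := B.Nonempty ∧ ∀ s ∈ B, ∀ t ∈ B, M.Reach s t

/-- (The vertex sets of) bottom strongly connected components. -/
def IsBSCC (B : Set S) : Prop :=
  Maximal M.StronglyConnected B ∧ ∀ s ∈ B, ∀ t, M.Edge s t → t ∈ B

/-- The states from which the set `B` can be reached. -/
def canReach (B : Set S) : Set S := {s | ∃ t ∈ B, M.Reach s t}

/-- `π 0, …, π m` is a path of length `m` of the graph of the chain.  (Finite paths are represented
by functions on `ℕ`, whose values after `m` are irrelevant.) -/
def IsPath (π : ℕ → S) (m : ℕ) : Prop := ∀ n < m, M.Edge (π n) (π (n + 1))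

/-- For a family `prog` of finite paths (`prog π m` is about the path `π 0, …, π m`): the maximum
over `s ∈ X` of the length of a shortest path in the family that starts at `s`. -/
noncomputable def radius (prog : (ℕ → S) → ℕ → Prop) (X : Set S) : ℕ :=
  sSup ((fun s => sInf {m | ∃ π : ℕ → S, π 0 = s ∧ prog π m}) '' X)

/-- The minimum over `s ∈ X` of the probability that a path of length `r` starting at `s` contains
a path of the family `prog`.  It is `⊤`, hence irrelevant in minima, if `X` is empty. -/
noncomputable def prob [Countable S] [MeasurableSpace S] [DiscreteMeasurableSpace S]
    (prog : (ℕ → S) → ℕ → Prop) (X : Set S) (r : ℕ) : ℝ≥0∞ :=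
  ⨅ s ∈ X, M.runMeasure s {ρ | ∃ a m, a + m ≤ r ∧ prog (fun n => ρ (a + n)) m}

end General

end POMC

/-- The markers `e_1, …, e_k, f_1, …, f_k`. -/
inductive Marker (k : ℕ)
  | e (i : Fin k)
  | f (i : Fin k)

/-- The Rabin language: for some `j`, the marker `e_j` occurs infinitely often and `f_j` finitely
often. -/
def rabinLanguage (k : ℕ) : Set (ℕ → Set (Marker k)) :=
  {w | ∃ j, {n | Marker.e j ∈ w n}.Infinite ∧ {n | Marker.f j ∈ w n}.Finite}

section RestartStrategy

variable {k : ℕ}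

/-- Goodness of a finite path, in terms of its list of observations (a path of length `m` has
`m + 1` observations). -/
def GoodPath (w : List (Set (Marker k))) : Prop :=
  ∃ i, w.length ≤ 1 ∨ ((∃ α ∈ w, Marker.e i ∈ α) ∧ ∀ α ∈ w, Marker.f i ∉ α)

/-- The second half of a path `s_0 … s_m` (given by its `m + 1` observations) is
`s_⌈m/2⌉ … s_m`. -/
def secondHalf (w : List (Set (Marker k))) : List (Set (Marker k)) :=
  w.drop (w.length / 2)

open Classical in
/-- The restart strategy for `f`.  Let `π` be the path, of length `m`, executed since the last
restart (or since the beginning), and let `n - 1` be the number of restarts so far.  The chain is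
sampled in blocks of `2 f(n)` steps, and it is restarted if at the end of a block the second half of
`π` is not good. -/
noncomputable def restartStrategy (f : ℕ → ℕ) : Strategy (Set (Marker k)) RestartAction :=
  fun l o =>
    let π := (l.rtakeWhile fun p => p.2 = RestartAction.cont).map Prod.fst ++ [o]
    let m := π.length - 1
    let n := (l.map Prod.snd).count RestartAction.restart + 1
    if 2 * f n ∣ m ∧ ¬ GoodPath (secondHalf π) then RestartAction.restart else RestartAction.cont

end RestartStrategy

/-- The number `S(ρ)` of steps up to the last restart (included) in a run of the chain induced on a
restart process; it is `0` if there is no restart, and `∞` if there are infinitely many.  The step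
from time `n` to time `n + 1` appends the action taken to the past. -/
noncomputable def stepsToLastRestart {S : Type*} (ρ : ℕ → History S RestartAction) : ℝ≥0∞ :=
  ⨆ (n : ℕ) (_ : ∃ l s, (ρ (n + 1)).past = l ++ [(s, RestartAction.restart)]), ((n + 1 : ℕ) : ℝ≥0∞)

namespace POMC

variable {k : ℕ} {S : Type*} (M : POMC S (Set (Marker k)))

/-- The probability of the good runs. -/
noncomputable def Pgood [Countable S] [MeasurableSpace S] [DiscreteMeasurableSpace S] : ℝ≥0∞ :=
  M.runMeasure M.init {ρ | (fun n => M.obs (ρ n)) ∈ rabinLanguage k}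

/-- A set of states is `i`-good if it has a state marked `e_i` and none marked `f_i`. -/
def IsGoodFor (i : Fin k) (B : Set S) : Prop :=
  (∃ s ∈ B, Marker.e i ∈ M.obs s) ∧ ∀ s ∈ B, Marker.f i ∉ M.obs s

/-- The states in good bottom components. -/
def goodBottom : Set S := {s | ∃ B, M.IsBSCC B ∧ s ∈ B ∧ ∃ i, M.IsGoodFor i B}

/-- The states in bad bottom components. -/
def badBottom : Set S := {s | ∃ B, M.IsBSCC B ∧ s ∈ B ∧ ¬ ∃ i, M.IsGoodFor i B}

/-- `π 0, …, π m` is a good progress path. -/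
def GoodProgress (π : ℕ → S) (m : ℕ) : Prop :=
  0 < m ∧ M.IsPath π m ∧
    ((π 0 ∈ M.canReach M.goodBottom \ M.goodBottom ∧ π m ∈ M.goodBottom) ∨
      ∃ B i, M.IsBSCC B ∧ π 0 ∈ B ∧ M.IsGoodFor i B ∧ Marker.e i ∈ M.obs (π m))

/-- `π 0, …, π m` is a bad progress path.  From a bad bottom component `B`, the path has to visit
the marker `f_i` for every `i` such that `e_i` occurs in `B`.  With `v = 0` the visit may be at any
state of the path; with `v = 1` the starting state does not count. -/
def BadProgress (v : ℕ) (π : ℕ → S) (m : ℕ) : Prop :=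
  0 < m ∧ M.IsPath π m ∧
    ((π 0 ∈ M.canReach M.badBottom \ M.badBottom ∧ π m ∈ M.badBottom) ∨
      ∃ B, M.IsBSCC B ∧ π 0 ∈ B ∧ (¬ ∃ i, M.IsGoodFor i B) ∧
        ∀ i, (∃ t ∈ B, Marker.e i ∈ M.obs t) →
          ∃ n, v ≤ n ∧ n ≤ m ∧ Marker.f i ∈ M.obs (π n))

/-- The good-reachability radius. -/
noncomputable def rGood : ℕ := radius M.GoodProgress (M.canReach M.goodBottom \ M.goodBottom)

/-- The good-witness radius. -/
noncomputable def RGood : ℕ := radius M.GoodProgress M.goodBottom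

/-- The bad-reachability radius. -/
noncomputable def rBad (v : ℕ) : ℕ :=
  radius (M.BadProgress v) (M.canReach M.badBottom \ M.badBottom)

/-- The bad-witness radius. -/
noncomputable def RBad (v : ℕ) : ℕ := radius (M.BadProgress v) M.badBottom

/-- The progress radius.  (A radius whose range of states is empty is `0`, and does not count.) -/
noncomputable def Rm (v : ℕ) : ℕ := max (max M.rGood M.RGood) (max (M.rBad v) (M.RBad v))

/-- The progress probability, the minimum of the good-reachability, good-witness, bad-reachability
and bad-witness probabilities. -/
noncomputable def Pm [Countable S] [MeasurableSpace S] [DiscreteMeasurableSpace S] (v : ℕ) :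
    ℝ≥0∞ :=
  min
    (min (M.prob M.GoodProgress (M.canReach M.goodBottom \ M.goodBottom) M.rGood)
      (M.prob M.GoodProgress M.goodBottom M.RGood))
    (min (M.prob (M.BadProgress v) (M.canReach M.badBottom \ M.badBottom) (M.rBad v))
      (M.prob (M.BadProgress v) M.badBottom (M.RBad v)))

/-- The expected number `E[S]` of steps to the last restart under the restart strategy for `f`. -/
noncomputable def expectedSteps [Countable S] (f : ℕ → ℕ) : ℝ≥0∞ :=
  let N := M.restartMDP.induced (restartStrategy f)
  ∫⁻ ρ, stepsToLastRestart ρ ∂(N.runMeasure N.init)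

end POMC

/-!
Let `W = Rm * ⌈1 / Pm⌉`: in a window of `W` steps no progress path occurs with probability at most
`1 / 2`, whatever the state at its beginning. Hence the chain is outside all bottom components after
`j * W` steps with probability at most `2⁻¹ ^ j`, and from then on, with the same error, every
second half of length `j * W` contains the marker `e_i` in a good component and the markers `f_i`
that refute it in a bad one.

A phase with block length `2 F` that is ended by a restart at all therefore ends after `O(F + W)`
expected steps: the decisions taken later are correct up to geometrically small errors. Once
`F ≥ (c + 3) * W`, the phase is ended with probability at most
`x = 1 - Pgood * (1 - 3 / 2 ^ (c + 3))`, since a good component is reached within `F` steps except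
for a fraction `1 / 2 ^ (c + 3)` of the runs reaching one, and then all the second halves are good
up to an error of `2 / 2 ^ (c + 3)`. The exponent `c + 3` makes the `(c + 1)`-st power of the
correction factor at least `1 / 2`.

Restarting begins an independent phase, so a function `Val` of the phase number bounds the expected
remaining steps as soon as `cost n + restartProb n * Val (n + 1) ≤ Val n`. For `F = n ^ c` the first
`N = ((c + 3) * W) ^ (1 / c)` phases cost `O(N * (c + 3) * W)`, which is the term
`(Rm / Pm) ^ (1 + 1 / c)`, and the later ones cost `∑ l, x ^ l * (N + l) ^ c`, which is compared
with `∑ l, (l + c).choose c * x ^ l = 1 / (1 - x) ^ (c + 1)`.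
-/

namespace POMC

section Paths

variable {S : Type*}

/-- The run obtained by putting the state `s` in front of `ρ`. -/
def cons (s : S) (ρ : ℕ → S) : ℕ → S
  | 0 => s
  | n + 1 => ρ n

@[simp] lemma cons_zero (s : S) (ρ : ℕ → S) : cons s ρ 0 = s := rfl

@[simp] lemma cons_succ (s : S) (ρ : ℕ → S) (n : ℕ) : cons s ρ (n + 1) = ρ n := rfl

/-- The run from time `n` on. -/
def shift (n : ℕ) (ρ : ℕ → S) : ℕ → S := fun m => ρ (n + m)

@[simp] lemma shift_apply (n : ℕ) (ρ : ℕ → S) (m : ℕ) : shift n ρ m = ρ (n + m) := rfl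

@[simp] lemma shift_zero (ρ : ℕ → S) : shift 0 ρ = ρ := by
  ext m; simp

@[simp] lemma shift_shift (m n : ℕ) (ρ : ℕ → S) : shift m (shift n ρ) = shift (n + m) ρ := by
  ext i; simp [add_assoc]

lemma shift_succ_cons (s : S) (n : ℕ) (ρ : ℕ → S) : shift (n + 1) (cons s ρ) = shift n ρ := by
  ext m; simp [shift, add_right_comm _ 1 m]

lemma measurable_cons [MeasurableSpace S] (s : S) : Measurable (cons s) := by
  refine measurable_pi_iff.2 fun n => ?_
  cases n with
  | zero => exact measurable_const
  | succ n => exact measurable_pi_apply n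

lemma measurable_shift [MeasurableSpace S] (n : ℕ) : Measurable (shift n : (ℕ → S) → ℕ → S) :=
  measurable_pi_iff.2 fun m => measurable_pi_apply (n + m)

lemma measurableSet_apply_mem [MeasurableSpace S] [DiscreteMeasurableSpace S] (n : ℕ)
    (Q : Set S) : MeasurableSet {ρ : ℕ → S | ρ n ∈ Q} :=
  measurable_pi_apply n (MeasurableSet.of_discrete (s := Q))

lemma measurableSet_exists_ge_mem [MeasurableSpace S] [DiscreteMeasurableSpace S] (Q : Set S)
    (n : ℕ) :
    MeasurableSet {ρ : ℕ → S | ∃ m, n ≤ m ∧ ρ (m + 1) ∈ Q} := by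
  simp only [Set.ofPred_exists, ← exists_prop]
  exact .iUnion fun m => .iUnion fun _ => measurableSet_apply_mem _ Q

lemma measurableSet_exists_lt_mem [MeasurableSpace S] [DiscreteMeasurableSpace S] (Q : Set S)
    (n : ℕ) :
    MeasurableSet {ρ : ℕ → S | ∃ m < n, ρ (m + 1) ∈ Q} := by
  simp only [Set.ofPred_exists, ← exists_prop]
  exact .iUnion fun m => .iUnion fun _ => measurableSet_apply_mem _ Q

/-- Membership in the event `A` is decided by the states at the times `0, …, n`. -/
def DecidedBy (n : ℕ) (A : Set (ℕ → S)) : Prop :=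
  ∀ ρ ρ' : ℕ → S, (∀ i ≤ n, ρ i = ρ' i) → ρ ∈ A → ρ' ∈ A

lemma decidedBy_apply_mem (n : ℕ) (Q : Set S) : DecidedBy n {ρ : ℕ → S | ρ n ∈ Q} :=
  fun _ _ h hρ => by simpa only [Set.mem_ofPred_eq, ← h n le_rfl] using hρ

lemma DecidedBy.cons {n : ℕ} {A : Set (ℕ → S)} (h : DecidedBy (n + 1) A) (s : S) :
    DecidedBy n (cons s ⁻¹' A) := by
  intro ρ ρ' hρ
  refine h _ _ fun i hi => ?_
  cases i with
  | zero => rfl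
  | succ i => exact hρ i (by omega)

lemma DecidedBy.measurableSet [Countable S] [MeasurableSpace S] [DiscreteMeasurableSpace S]
    {n : ℕ} {A : Set (ℕ → S)} (h : DecidedBy n A) : MeasurableSet A := by
  have hA : A = (Preorder.frestrictLe (π := fun _ => S) n) ⁻¹'
      ((Preorder.frestrictLe (π := fun _ => S) n) '' A) := by
    refine Set.Subset.antisymm (Set.subset_preimage_image _ _) ?_
    rintro ρ ⟨ρ', hρ', he⟩
    exact h ρ' ρ (fun i hi => congrFun he ⟨i, Finset.mem_Iic.2 hi⟩) hρ'
  rw [hA]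
  exact (Preorder.measurable_frestrictLe n) .of_discrete

/-- The runs that agree with `x` up to time `n`. -/
def cylinder (n : ℕ) (x : ℕ → S) : Set (ℕ → S) := {ρ | ∀ i ≤ n, ρ i = x i}

lemma decidedBy_cylinder (n : ℕ) (x : ℕ → S) : DecidedBy n (cylinder n x) :=
  fun _ _ h hρ i hi => (h i hi).symm.trans (hρ i hi)

lemma cons_preimage_cylinder_of_ne {s : S} {x : ℕ → S} (h : x 0 ≠ s) (n : ℕ) :
    cons s ⁻¹' cylinder n x = ∅ :=
  Set.eq_empty_of_forall_notMem fun _ hρ => h (hρ 0 n.zero_le).symm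

lemma cons_preimage_cylinder_zero {s : S} {x : ℕ → S} (h : x 0 = s) :
    cons s ⁻¹' cylinder 0 x = Set.univ := by
  ext ρ; simp [cylinder, h]

lemma cons_preimage_cylinder_succ {s : S} {x : ℕ → S} (h : x 0 = s) (n : ℕ) :
    cons s ⁻¹' cylinder (n + 1) x = cylinder n fun i => x (i + 1) := by
  ext ρ
  refine ⟨fun hρ i hi => hρ (i + 1) (by omega), fun hρ i hi => ?_⟩
  cases i with
  | zero => exact h.symm
  | succ i => exact hρ i (by omega)

lemma frestrictLe_preimage_singleton (n : ℕ) (y : Π _ : Finset.Iic n, S) :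
    Preorder.frestrictLe (π := fun _ => S) n ⁻¹' {y} =
      cylinder n fun i => y ⟨min i n, Finset.mem_Iic.2 (min_le_right _ _)⟩ := by
  ext ρ
  constructor
  · rintro rfl i hi
    simp [hi]
  · intro hρ
    ext ⟨i, hi⟩
    simpa [Finset.mem_Iic.1 hi] using hρ i (Finset.mem_Iic.1 hi)

lemma measure_eq_of_cylinder [Countable S] [MeasurableSpace S] [DiscreteMeasurableSpace S]
    {μ ν : Measure (ℕ → S)} [IsProbabilityMeasure μ] [IsProbabilityMeasure ν]
    (h : ∀ n x, μ (cylinder n x) = ν (cylinder n x)) : μ = ν := by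
  have hmap : ∀ n, μ.map (Preorder.frestrictLe (π := fun _ => S) n) =
      ν.map (Preorder.frestrictLe (π := fun _ => S) n) := by
    refine fun n => Measure.ext_of_singleton fun y => ?_
    rw [Measure.map_apply (Preorder.measurable_frestrictLe n) .of_discrete,
      Measure.map_apply (Preorder.measurable_frestrictLe n) .of_discrete,
      frestrictLe_preimage_singleton, h]
  have hfamily : IsProjectiveMeasureFamily (α := fun _ : ℕ => S)
      fun I : Finset ℕ => ν.map I.restrict := by
    intro I J hJ
    rw [Measure.map_map (Finset.measurable_restrict₂ hJ) (Finset.measurable_restrict I)]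
    rfl
  have hμ : IsProjectiveLimit (α := fun _ : ℕ => S) μ fun I : Finset ℕ => ν.map I.restrict :=
    (isProjectiveLimit_nat_iff hfamily μ).2 hmap
  have hν : IsProjectiveLimit (α := fun _ : ℕ => S) ν fun I : Finset ℕ => ν.map I.restrict :=
    fun _ => rfl
  exact hν.unique hμ |>.symm

end Paths

section Run

variable {S O : Type*} [Countable S] [MeasurableSpace S] [DiscreteMeasurableSpace S]
  (M : POMC S O)

instance (s : S) : IsProbabilityMeasure (M.runMeasure s) := by
  unfold runMeasure; infer_instance

open Classical in
lemma runMeasure_cylinder_zero (s : S) (x : ℕ → S) :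
    M.runMeasure s (cylinder 0 x) = if x 0 = s then 1 else 0 := by
  have h := Kernel.traj_map_frestrictLe_apply (X := fun _ => S) (κ := M.stepKernel) 0 0 (fun _ => s)
  rw [Kernel.partialTraj_self, Kernel.id_apply] at h
  have hc : cylinder 0 x = (Preorder.frestrictLe (π := fun _ => S) 0) ⁻¹'
      {y | y ⟨0, by simp⟩ = x 0} := by
    ext ρ; simp [cylinder]
  rw [hc, ← Measure.map_apply (Preorder.measurable_frestrictLe 0) .of_discrete, runMeasure, h,
    Measure.dirac_apply' _ .of_discrete]
  simp [Set.indicator_apply, eq_comm]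

lemma stepKernel_singleton (n : ℕ) (y : Π _ : Finset.Iic n, S) (t : S) :
    M.stepKernel n y {t} = M.step (y ⟨n, Finset.mem_Iic.2 le_rfl⟩) t := by
  rw [stepKernel, Kernel.comap_apply]
  exact PMF.toMeasure_apply_singleton _ _ .of_discrete

lemma runMeasure_cylinder_succ (s : S) (n : ℕ) (x : ℕ → S) :
    M.runMeasure s (cylinder (n + 1) x) =
      M.runMeasure s (cylinder n x) * M.step (x n) (x (n + 1)) := by
  have hcomp := Kernel.partialTraj_compProd_eq_map_traj (X := fun _ => S) (κ := M.stepKernel)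
    (Nat.zero_le n) (x₀ := fun _ => s)
  rw [← Kernel.traj_map_frestrictLe_apply] at hcomp
  set A : Set (Π _ : Finset.Iic n, S) := {y | ∀ i, y i = x i} with hA
  have hcyl : cylinder n x = (Preorder.frestrictLe (π := fun _ => S) n) ⁻¹' A := by
    ext ρ
    simp [cylinder, hA]
  have hcyl_succ : cylinder (n + 1) x = (fun ρ : ℕ → S =>
      (Preorder.frestrictLe (π := fun _ => S) n ρ, ρ (n + 1))) ⁻¹' (A ×ˢ {x (n + 1)}) := by
    rw [Set.mk_preimage_prod, ← hcyl]
    ext ρ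
    simp [cylinder, Nat.le_add_one_iff, or_imp, forall_and]
  have hm : Measurable (fun ρ : ℕ → S =>
      (Preorder.frestrictLe (π := fun _ => S) n ρ, ρ (n + 1))) :=
    (Preorder.measurable_frestrictLe n).prodMk (measurable_pi_apply _)
  have hstep : ∀ y ∈ A, M.stepKernel n y {x (n + 1)} = M.step (x n) (x (n + 1)) :=
    fun y hy => by rw [stepKernel_singleton, hy]
  rw [hcyl_succ, hcyl, ← Measure.map_apply hm (.prod .of_discrete .of_discrete),
    ← Measure.map_apply (Preorder.measurable_frestrictLe n) .of_discrete, runMeasure, ← hcomp,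
    Measure.compProd_apply_prod .of_discrete .of_discrete,
    setLIntegral_congr_fun .of_discrete hstep, setLIntegral_const, mul_comm]

open Classical in
lemma runMeasure_cylinder (s : S) (n : ℕ) (x : ℕ → S) :
    M.runMeasure s (cylinder n x) =
      if x 0 = s then ∏ i ∈ Finset.range n, M.step (x i) (x (i + 1)) else 0 := by
  induction n with
  | zero => simp [runMeasure_cylinder_zero]
  | succ n ih =>
    rw [runMeasure_cylinder_succ, ih, Finset.prod_range_succ]
    split_ifs <;> simp

lemma runMeasure_cylinder_eq_tsum (s : S) (n : ℕ) (x : ℕ → S) :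
    M.runMeasure s (cylinder n x) =
      ∑' t, M.step s t * M.runMeasure t (cons s ⁻¹' cylinder n x) := by
  classical
  by_cases hx : x 0 = s
  · cases n with
    | zero => simp [runMeasure_cylinder_zero, cons_preimage_cylinder_zero hx, hx, PMF.tsum_coe]
    | succ n =>
      simp only [cons_preimage_cylinder_succ hx, runMeasure_cylinder]
      rw [tsum_eq_single (x 1) fun t ht => by simp [Ne.symm ht]]
      simp [Finset.prod_range_succ', hx, mul_comm]
  · simp [cons_preimage_cylinder_of_ne hx, runMeasure_cylinder, hx]

lemma runMeasure_eq_sum (s : S) :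
    M.runMeasure s = Measure.sum fun t => M.step s t • (M.runMeasure t).map (cons s) := by
  have happly {E : Set (ℕ → S)} (hE : MeasurableSet E) :
      Measure.sum (fun t => M.step s t • (M.runMeasure t).map (cons s)) E =
        ∑' t, M.step s t * M.runMeasure t (cons s ⁻¹' E) := by
    simp only [Measure.sum_apply _ hE, Measure.smul_apply, smul_eq_mul,
      Measure.map_apply (measurable_cons s) hE]
  have : IsProbabilityMeasure
      (Measure.sum fun t => M.step s t • (M.runMeasure t).map (cons s)) := by
    refine ⟨?_⟩
    simp [happly .univ, PMF.tsum_coe]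
  refine measure_eq_of_cylinder fun n x => ?_
  rw [happly (decidedBy_cylinder n x).measurableSet, runMeasure_cylinder_eq_tsum]

lemma lintegral_runMeasure (s : S) {f : (ℕ → S) → ℝ≥0∞} (hf : Measurable f) :
    ∫⁻ ρ, f ρ ∂M.runMeasure s = ∑' t, M.step s t * ∫⁻ ρ, f (cons s ρ) ∂M.runMeasure t := by
  conv_lhs => rw [runMeasure_eq_sum]
  simp only [lintegral_sum_measure, lintegral_smul_measure, lintegral_map hf (measurable_cons s),
    smul_eq_mul]

lemma runMeasure_apply (s : S) {E : Set (ℕ → S)} (hE : MeasurableSet E) :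
    M.runMeasure s E = ∑' t, M.step s t * M.runMeasure t (cons s ⁻¹' E) := by
  conv_lhs => rw [runMeasure_eq_sum]
  simp only [Measure.sum_apply _ hE, Measure.smul_apply, Measure.map_apply (measurable_cons s) hE,
    smul_eq_mul]

lemma ae_zero_eq (s : S) : ∀ᵐ ρ ∂M.runMeasure s, ρ 0 = s := by
  have h : ∀ᵐ ρ ∂M.runMeasure s, ρ ∈ cylinder 0 fun _ => s :=
    (mem_ae_iff_prob_eq_one (decidedBy_cylinder 0 _).measurableSet).2
      (by simp [runMeasure_cylinder_zero])
  filter_upwards [h] with ρ hρ using hρ 0 le_rfl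

lemma ae_eq_univ_or_ae_eq_empty (s : S) {A : Set (ℕ → S)} (hA : DecidedBy 0 A) :
    A =ᵐ[M.runMeasure s] Set.univ ∨ A =ᵐ[M.runMeasure s] (∅ : Set (ℕ → S)) := by
  have hiff : ∀ᵐ ρ ∂M.runMeasure s, ρ ∈ A ↔ (fun _ => s) ∈ A := by
    filter_upwards [M.ae_zero_eq s] with ρ hρ
    have heq : ∀ i ≤ 0, ρ i = s := fun i hi => by rwa [Nat.le_zero.1 hi]
    exact ⟨hA _ _ heq, hA _ _ fun i hi => (heq i hi).symm⟩
  by_cases hs : (fun _ => s) ∈ A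
  · exact .inl (Filter.eventuallyEq_univ.2 (hiff.mono fun ρ hρ => hρ.2 hs))
  · exact .inr (Filter.eventuallyEq_empty.2 (hiff.mono fun ρ hρ => mt hρ.1 hs))

lemma runMeasure_inter_shift (s : S) (n : ℕ) {A E : Set (ℕ → S)} (hA : DecidedBy n A)
    (hE : MeasurableSet E) :
    M.runMeasure s (A ∩ shift n ⁻¹' E) = ∫⁻ ρ in A, M.runMeasure (ρ n) E ∂M.runMeasure s := by
  induction n generalizing s A with
  | zero =>
    have hzero : ∀ᵐ ρ ∂M.runMeasure s, M.runMeasure (ρ 0) E = M.runMeasure s E := by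
      filter_upwards [M.ae_zero_eq s] with ρ h
      rw [h]
    have hshift : shift 0 ⁻¹' E = E := by ext; simp
    rw [hshift]
    rcases M.ae_eq_univ_or_ae_eq_empty s hA with h | h
    · rw [measure_congr (h.inter (ae_eq_refl E)), Measure.restrict_congr_set h,
        Measure.restrict_univ, lintegral_congr_ae hzero]
      simp
    · rw [measure_congr (h.inter (ae_eq_refl E)), Measure.restrict_congr_set h]
      simp
  | succ n ih =>
    have hE' : Measurable fun ρ : ℕ → S => M.runMeasure (ρ (n + 1)) E :=
      (Measurable.of_discrete (f := fun t => M.runMeasure t E)).comp (measurable_pi_apply _)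
    rw [M.runMeasure_apply s (hA.measurableSet.inter (measurable_shift _ hE)),
      ← lintegral_indicator hA.measurableSet,
      M.lintegral_runMeasure s (hE'.indicator hA.measurableSet)]
    refine tsum_congr fun t => congrArg _ ?_
    have hcons : cons s ⁻¹' (A ∩ shift (n + 1) ⁻¹' E) = (cons s ⁻¹' A) ∩ shift n ⁻¹' E := by
      ext ρ
      simp [shift_succ_cons]
    rw [hcons, ih t (hA.cons s), ← lintegral_indicator (hA.cons s).measurableSet]
    rfl

lemma runMeasure_inter_shift_le (s : S) (n : ℕ) {A E : Set (ℕ → S)} (hA : DecidedBy n A)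
    (hE : MeasurableSet E) {b : ℝ≥0∞} (hb : ∀ t, M.runMeasure t E ≤ b) :
    M.runMeasure s (A ∩ shift n ⁻¹' E) ≤ b * M.runMeasure s A := by
  rw [M.runMeasure_inter_shift s n hA hE, ← setLIntegral_const]
  exact lintegral_mono fun ρ => hb _

lemma runMeasure_shift_le (s : S) (n : ℕ) {E : Set (ℕ → S)}
    (hE : MeasurableSet E) {b : ℝ≥0∞} (hb : ∀ t, M.runMeasure t E ≤ b) :
    M.runMeasure s (shift n ⁻¹' E) ≤ b := by
  simpa using M.runMeasure_inter_shift_le s n (A := Set.univ) (fun _ _ _ _ => trivial) hE hb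

lemma ae_isPath (s : S) : ∀ᵐ ρ ∂M.runMeasure s, ∀ n, M.Edge (ρ n) (ρ (n + 1)) := by
  set E : Set (ℕ → S) := {ρ | ¬ M.Edge (ρ 0) (ρ 1)} with hE
  have hEm : MeasurableSet E := by
    refine DecidedBy.measurableSet (n := 1) fun ρ ρ' h hρ => ?_
    simpa only [hE, Set.mem_ofPred_eq, ← h 0 zero_le_one, ← h 1 le_rfl] using hρ
  have hnull : ∀ t, M.runMeasure t E ≤ 0 := by
    intro t
    rw [M.runMeasure_apply t hEm]
    refine le_of_eq (ENNReal.tsum_eq_zero.2 fun u => ?_)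
    by_cases hu : M.Edge t u
    · refine mul_eq_zero_of_right _ (measure_eq_zero_iff_ae_notMem.2 ?_)
      filter_upwards [M.ae_zero_eq u] with ρ h
      simp [hE, h, hu]
    · exact mul_eq_zero_of_left (by simpa [Edge] using hu) _
  exact ae_all_iff.2 fun n => ae_iff.2 (nonpos_iff_eq_zero.1 (M.runMeasure_shift_le s n hEm hnull))

lemma runMeasure_iterate_le {r : ℕ} {A : Set (ℕ → S)} (hA : DecidedBy r A) {b : ℝ≥0∞}
    (hb : ∀ t, M.runMeasure t A ≤ b) (k : ℕ) (s : S) :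
    M.runMeasure s {ρ | ∀ j < k, shift (j * r) ρ ∈ A} ≤ b ^ k := by
  have hm : ∀ k, MeasurableSet {ρ : ℕ → S | ∀ j < k, shift (j * r) ρ ∈ A} := by
    intro k
    simp only [Set.ofPred_forall]
    exact .iInter fun j => .iInter fun _ => measurable_shift _ hA.measurableSet
  induction k generalizing s with
  | zero => simp
  | succ k ih =>
    have hsucc : {ρ : ℕ → S | ∀ j < k + 1, shift (j * r) ρ ∈ A} =
        A ∩ shift r ⁻¹' {ρ | ∀ j < k, shift (j * r) ρ ∈ A} := by
      ext ρ
      simp only [Set.mem_ofPred_eq, Nat.forall_lt_succ_left, Set.mem_inter_iff, Set.mem_preimage,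
        shift_shift, zero_mul, shift_zero, add_mul, one_mul, add_comm r]
    rw [hsucc, pow_succ]
    exact (M.runMeasure_inter_shift_le s r hA (hm k) ih).trans (by gcongr; exact hb s)

end Run

section LastVisit

variable {S O : Type*} [Countable S] [MeasurableSpace S] [DiscreteMeasurableSpace S]
  (M : POMC S O)

open Classical in
lemma runMeasure_exists_lt_mem_le {Q : Set S} {u : S → ℝ≥0∞}
    (hu : ∀ s, ∑' t, M.step s t * (if t ∈ Q then 1 else u t) ≤ u s) (H : ℕ) (s : S) :
    M.runMeasure s {ρ | ∃ m < H, ρ (m + 1) ∈ Q} ≤ u s := by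
  induction H generalizing s with
  | zero => simp
  | succ H ih =>
    rw [M.runMeasure_apply s (measurableSet_exists_lt_mem Q _)]
    refine (ENNReal.tsum_le_tsum fun t => mul_le_mul_right ?_ _).trans (hu s)
    split_ifs with ht
    · exact prob_le_one
    · refine (measure_mono_ae ?_).trans (ih t)
      filter_upwards [M.ae_zero_eq t] with ρ hρ
      rintro ⟨m, hm, hmQ⟩
      cases m with
      | zero => exact absurd (hρ ▸ hmQ) ht
      | succ m => exact ⟨m, by omega, hmQ⟩

open Classical in
lemma runMeasure_exists_mem_le {Q : Set S} {u : S → ℝ≥0∞}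
    (hu : ∀ s, ∑' t, M.step s t * (if t ∈ Q then 1 else u t) ≤ u s) (s : S) :
    M.runMeasure s {ρ | ∃ m, ρ (m + 1) ∈ Q} ≤ u s := by
  have hunion : {ρ : ℕ → S | ∃ m, ρ (m + 1) ∈ Q} = ⋃ H, {ρ | ∃ m < H, ρ (m + 1) ∈ Q} := by
    ext ρ
    simp only [Set.mem_ofPred_eq, Set.mem_iUnion]
    exact ⟨fun ⟨m, hm⟩ => ⟨m + 1, m, m.lt_succ_self, hm⟩, fun ⟨_, m, _, hm⟩ => ⟨m, hm⟩⟩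
  have hmono : Monotone fun H => {ρ : ℕ → S | ∃ m < H, ρ (m + 1) ∈ Q} :=
    fun H H' h ρ ⟨m, hm, hmQ⟩ => ⟨m, hm.trans_le h, hmQ⟩
  rw [hunion, hmono.measure_iUnion]
  exact iSup_le fun H => M.runMeasure_exists_lt_mem_le hu H s

lemma runMeasure_exists_ge_mem_succ (Q : Set S) (n : ℕ) (s : S) :
    M.runMeasure s {ρ | ∃ m, n + 1 ≤ m ∧ ρ (m + 1) ∈ Q} =
      ∑' t, M.step s t * M.runMeasure t {ρ | ∃ m, n ≤ m ∧ ρ (m + 1) ∈ Q} := by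
  rw [M.runMeasure_apply s (measurableSet_exists_ge_mem Q _)]
  have hcons : cons s ⁻¹' {ρ | ∃ m, n + 1 ≤ m ∧ ρ (m + 1) ∈ Q} =
      {ρ | ∃ m, n ≤ m ∧ ρ (m + 1) ∈ Q} := by
    ext ρ
    constructor
    · rintro ⟨m, hm, hmQ⟩
      obtain ⟨m, rfl⟩ := Nat.exists_eq_add_of_le' (Nat.le_of_succ_le hm)
      obtain ⟨i, hi⟩ := Nat.exists_eq_add_of_lt hm
      exact ⟨n + i, by omega, by rwa [hi] at hmQ⟩
    · rintro ⟨m, hm, hmQ⟩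
      exact ⟨m + 1, by omega, hmQ⟩
  rw [hcons]

lemma tsum_runMeasure_exists_ge_mem_le {Q : Set S} {u V : S → ℝ≥0∞}
    (hu : ∀ s, M.runMeasure s {ρ | ∃ m, ρ (m + 1) ∈ Q} ≤ u s)
    (hV : ∀ s, u s + ∑' t, M.step s t * V t ≤ V s) (s : S) :
    ∑' n, M.runMeasure s {ρ | ∃ m, n ≤ m ∧ ρ (m + 1) ∈ Q} ≤ V s := by
  refine ENNReal.tsum_le_of_sum_range_le fun H => ?_
  induction H generalizing s with
  | zero => simp
  | succ H ih =>
    rw [Finset.sum_range_succ', add_comm]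
    simp only [runMeasure_exists_ge_mem_succ, ← Summable.tsum_finsetSum fun _ _ => ENNReal.summable,
      ← Finset.mul_sum]
    refine le_trans (add_le_add (by simpa using hu s) ?_) (hV s)
    exact ENNReal.tsum_le_tsum fun t => mul_le_mul_right (ih t) _

open Classical in
lemma lintegral_lastVisit_le {Q : Set S} {u V : S → ℝ≥0∞}
    (hu : ∀ s, ∑' t, M.step s t * (if t ∈ Q then 1 else u t) ≤ u s)
    (hV : ∀ s, u s + ∑' t, M.step s t * V t ≤ V s) (s : S) :
    ∫⁻ ρ, (⨆ (n : ℕ) (_ : ρ (n + 1) ∈ Q), ((n + 1 : ℕ) : ℝ≥0∞)) ∂M.runMeasure s ≤ V s := by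
  set later : ℕ → Set (ℕ → S) := fun n => {ρ | ∃ m, n ≤ m ∧ ρ (m + 1) ∈ Q}
  -- The time of the last visit is the number of `n` with a visit after time `n`.
  have hlast (ρ : ℕ → S) : ⨆ (n : ℕ) (_ : ρ (n + 1) ∈ Q), ((n + 1 : ℕ) : ℝ≥0∞) ≤
      ∑' n, (later n).indicator 1 ρ := by
    refine iSup₂_le fun n hn => ?_
    calc ((n + 1 : ℕ) : ℝ≥0∞) = ∑ i ∈ Finset.range (n + 1), (later i).indicator 1 ρ := by
          rw [Finset.sum_congr rfl fun i hi => Set.indicator_of_mem (s := later i)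
            ⟨n, Nat.lt_succ_iff.1 (Finset.mem_range.1 hi), hn⟩ 1]
          simp
      _ ≤ ∑' i, (later i).indicator 1 ρ := ENNReal.sum_le_tsum _
  have hmeas (n : ℕ) : MeasurableSet (later n) := measurableSet_exists_ge_mem Q n
  calc _ ≤ ∫⁻ ρ, ∑' n, (later n).indicator 1 ρ ∂M.runMeasure s := lintegral_mono hlast
    _ = ∑' n, M.runMeasure s (later n) := by
        rw [lintegral_tsum fun n => (measurable_one.indicator (hmeas n)).aemeasurable]
        simp only [lintegral_indicator_one (hmeas _)]
    _ ≤ V s := M.tsum_runMeasure_exists_ge_mem_le (M.runMeasure_exists_mem_le hu) hV s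

end LastVisit

section Prepend

variable {S : Type*}

/-- The run that starts with the states in the list `w` and goes on with `ρ`. -/
def prepend : List S → (ℕ → S) → ℕ → S
  | [], ρ => ρ
  | s :: w, ρ => cons s (prepend w ρ)

lemma prepend_append_singleton (w : List S) (s : S) (ρ : ℕ → S) :
    prepend (w ++ [s]) ρ = prepend w (cons s ρ) := by
  induction w with
  | nil => rfl
  | cons t w ih => simp only [List.cons_append, prepend, ih]

lemma measurable_prepend [MeasurableSpace S] (w : List S) : Measurable (prepend w) := by
  induction w with
  | nil => exact measurable_id
  | cons s w ih => exact (measurable_cons s).comp ih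

lemma map_range_prepend {T : Type*} (g : S → T) (w : List S) (ρ : ℕ → S) :
    (List.range (w.length + 1)).map (fun i => g (prepend w ρ i)) = w.map g ++ [g (ρ 0)] := by
  induction w with
  | nil => simp [prepend]
  | cons s w ih =>
    rw [List.length_cons, List.range_succ_eq_map, List.map_cons, List.map_cons, List.cons_append,
      ← ih, List.map_map]
    rfl

end Prepend

section FirstBad

/-- There is a time `t` with `bad t`, and none before `j`. -/
def FirstBadFrom (bad : ℕ → Prop) (j : ℕ) : Prop := (∀ i < j, ¬ bad i) ∧ ∃ t, bad t

lemma FirstBadFrom.anti {bad : ℕ → Prop} {i j : ℕ} (h : FirstBadFrom bad j) (hij : i ≤ j) :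
    FirstBadFrom bad i :=
  ⟨fun n hn => h.1 n (hn.trans_le hij), h.2⟩

lemma firstBadFrom_zero {bad : ℕ → Prop} : FirstBadFrom bad 0 ↔ ∃ t, bad t := by
  simp [FirstBadFrom]

lemma not_firstBadFrom_succ {bad : ℕ → Prop} (h : bad 0) (j : ℕ) : ¬ FirstBadFrom bad (j + 1) :=
  fun hj => hj.1 0 j.succ_pos h

lemma exists_iff_exists_succ {bad : ℕ → Prop} (h : ¬ bad 0) :
    (∃ t, bad t) ↔ ∃ t, bad (t + 1) := by
  rw [← Nat.or_exists_add_one, or_iff_right h]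

lemma firstBadFrom_succ_iff {bad : ℕ → Prop} (h : ¬ bad 0) {j : ℕ} :
    FirstBadFrom bad (j + 1) ↔ FirstBadFrom (fun t => bad (t + 1)) j := by
  simp only [FirstBadFrom, exists_iff_exists_succ h, Nat.forall_lt_succ_left, h, not_false_eq_true,
    true_and]

lemma measurableSet_firstBadFrom {Ω : Type*} [MeasurableSpace Ω] {bad : Ω → ℕ → Prop}
    (h : ∀ t, MeasurableSet {ω | bad ω t}) (j : ℕ) :
    MeasurableSet {ω | FirstBadFrom (bad ω) j} := by
  simp only [FirstBadFrom, Set.ofPred_and, Set.ofPred_forall, Set.ofPred_exists]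
  exact .inter (.iInter fun i => .iInter fun _ => (h i).compl) (.iUnion h)

end FirstBad

lemma tsum_pmf_map_mul {α β : Type*} (p : PMF α) (f : α → β) (g : β → ℝ≥0∞) :
    ∑' b, p.map f b * g b = ∑' a, p a * g (f a) := by
  classical
  simp only [PMF.map_apply, ← ENNReal.tsum_mul_right]
  rw [ENNReal.tsum_comm]
  refine tsum_congr fun a => ?_
  rw [tsum_eq_single (f a) fun b hb => by simp [hb]]
  simp

section Phases

variable {k : ℕ} {S : Type*} (M : POMC S (Set (Marker k)))

/-- The event, for a phase with block length `2 F`, that the block ending at time `t` is followed by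
a restart: the second half of the path executed until `t` is not good. -/
def BadAt (F : ℕ) (ρ : ℕ → S) (t : ℕ) : Prop :=
  2 * F ∣ t ∧ ¬ GoodPath (secondHalf ((List.range (t + 1)).map fun i => M.obs (ρ i)))

lemma decidedBy_badAt (F t : ℕ) : DecidedBy t {ρ | M.BadAt F ρ t} := by
  rintro ρ ρ' h ⟨hdvd, hbad⟩
  have hobs : (List.range (t + 1)).map (fun i => M.obs (ρ' i)) =
      (List.range (t + 1)).map fun i => M.obs (ρ i) :=
    List.map_congr_left fun i hi => by rw [h i (Nat.lt_succ_iff.1 (List.mem_range.1 hi))]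
  exact ⟨hdvd, by rwa [hobs]⟩

/-- The history that extends `h` by the action `a` and the state `s`. -/
def extend {A : Type*} (h : History S A) (a : A) (s : S) : History S A :=
  ⟨h.past ++ [(h.last, a)], s⟩

@[simp] lemma extend_last {A : Type*} (h : History S A) (a : A) (s : S) :
    (extend h a s).last = s := rfl

/-- The states visited since the last restart, without the current one. -/
def phaseStates (h : History S RestartAction) : List S :=
  (h.past.rtakeWhile fun p => p.2 = RestartAction.cont).map Prod.fst

/-- The number of the current phase. -/
def phaseNumber (h : History S RestartAction) : ℕ :=
  (h.past.map Prod.snd).count RestartAction.restart + 1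

/-- The histories whose last action is a restart. -/
def restarted (S : Type*) : Set (History S RestartAction) :=
  {h | ∃ l s, h.past = l ++ [(s, RestartAction.restart)]}

variable (h : History S RestartAction)

lemma extend_restart_mem_restarted (s : S) : extend h .restart s ∈ restarted S :=
  ⟨h.past, h.last, rfl⟩

lemma extend_cont_notMem_restarted (s : S) : extend h .cont s ∉ restarted S := by
  rintro ⟨l, t, hl⟩
  simpa using (List.append_inj' hl rfl).2

lemma phaseStates_extend_restart (s : S) : phaseStates (extend h .restart s) = [] := by
  simp [phaseStates, extend, List.rtakeWhile]

lemma phaseStates_extend_cont (s : S) :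
    phaseStates (extend h .cont s) = phaseStates h ++ [h.last] := by
  simp [phaseStates, extend, List.rtakeWhile]

lemma phaseNumber_extend_restart (s : S) :
    phaseNumber (extend h .restart s) = phaseNumber h + 1 := by
  simp [phaseNumber, extend]

lemma phaseNumber_extend_cont (s : S) : phaseNumber (extend h .cont s) = phaseNumber h := by
  simp [phaseNumber, extend]

/-- The action of the restart strategy for `f` after the history `h`. -/
noncomputable def nextAction (f : ℕ → ℕ) (h : History S RestartAction) : RestartAction :=
  restartStrategy f (h.past.map fun p => (M.obs p.1, p.2)) (M.obs h.last)

/-- `BadAt` for the rest of the current phase: after the history `h`, the phase goes on with the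
states `ρ 0 = h.last, ρ 1, …`, and the time `t` is counted from the present. -/
def BadAfter (f : ℕ → ℕ) (h : History S RestartAction) (ρ : ℕ → S) (t : ℕ) : Prop :=
  M.BadAt (f (phaseNumber h)) (prepend (phaseStates h) ρ) ((phaseStates h).length + t)

lemma nextAction_eq_restart_iff (f : ℕ → ℕ) {ρ : ℕ → S} (hρ : ρ 0 = h.last) :
    M.nextAction f h = .restart ↔ M.BadAfter f h ρ 0 := by
  have hobs : ((h.past.map fun p => (M.obs p.1, p.2)).rtakeWhile
      fun p => p.2 = RestartAction.cont).map Prod.fst = (phaseStates h).map M.obs := by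
    simp only [phaseStates, List.rtakeWhile, ← List.map_reverse, List.takeWhile_map, List.map_map]
    rfl
  have hcount : ((h.past.map fun p => (M.obs p.1, p.2)).map Prod.snd).count RestartAction.restart +
      1 = phaseNumber h := by
    rw [List.map_map]
    rfl
  rw [nextAction, restartStrategy, BadAfter, BadAt, add_zero, map_range_prepend, hρ]
  rw [hobs, hcount]
  simp

lemma not_badAfter_zero_of_cont {f : ℕ → ℕ} {h : History S RestartAction}
    (hc : M.nextAction f h = .cont) (ρ : ℕ → S) :
    ¬ M.BadAfter f h (cons h.last ρ) 0 := by
  rw [← M.nextAction_eq_restart_iff h f (cons_zero h.last ρ), hc]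
  exact RestartAction.noConfusion

lemma badAfter_extend_cont (f : ℕ → ℕ) (s : S) (ρ : ℕ → S) :
    M.BadAfter f (extend h .cont s) ρ = fun t => M.BadAfter f h (cons h.last ρ) (t + 1) := by
  ext t
  rw [BadAfter, BadAfter, phaseStates_extend_cont, phaseNumber_extend_cont,
    prepend_append_singleton, List.length_append, List.length_singleton, add_assoc, add_comm 1 t]

lemma badAfter_extend_restart (f : ℕ → ℕ) (s : S) (ρ : ℕ → S) :
    M.BadAfter f (extend h .restart s) ρ = M.BadAt (f (phaseNumber h + 1)) ρ := by
  ext t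
  rw [BadAfter, phaseStates_extend_restart, phaseNumber_extend_restart, List.length_nil, zero_add]
  rfl

lemma tsum_induced_step_of_restart {f : ℕ → ℕ} {h : History S RestartAction}
    (hr : M.nextAction f h = .restart) (g : History S RestartAction → ℝ≥0∞) :
    ∑' h', (M.restartMDP.induced (restartStrategy f)).step h h' * g h' =
      g (extend h .restart M.init) := by
  have hstep : (M.restartMDP.induced (restartStrategy f)).step h =
      (PMF.pure M.init).map (extend h .restart) := by
    simp only [nextAction] at hr
    simp only [POMDP.induced, restartMDP, hr]
    rfl
  rw [hstep, tsum_pmf_map_mul, tsum_eq_single M.init fun s hs => by simp [hs]]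
  simp

lemma tsum_induced_step_of_cont {f : ℕ → ℕ} {h : History S RestartAction}
    (hc : M.nextAction f h = .cont) (g : History S RestartAction → ℝ≥0∞) :
    ∑' h', (M.restartMDP.induced (restartStrategy f)).step h h' * g h' =
      ∑' s, M.step h.last s * g (extend h .cont s) := by
  have hstep : (M.restartMDP.induced (restartStrategy f)).step h =
      (M.step h.last).map (extend h .cont) := by
    simp only [nextAction] at hc
    simp only [POMDP.induced, restartMDP, hc]
    rfl
  rw [hstep, tsum_pmf_map_mul]

variable [Countable S] [MeasurableSpace S] [DiscreteMeasurableSpace S]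

/-- The probability that a phase with block length `2 F` ends with a restart, at time `j` or
later. -/
noncomputable def restartProb (F j : ℕ) : ℝ≥0∞ :=
  M.runMeasure M.init {ρ | FirstBadFrom (M.BadAt F ρ) j}

/-- The expected number of steps of a phase with block length `2 F`, counted only if the phase is
finite.  The restart itself is a step, so a phase that ends at time `t` contributes `t + 1`. -/
noncomputable def phaseCost (F : ℕ) : ℝ≥0∞ := ∑' j, M.restartProb F j

/-- The probability, after the history `h`, that the current phase ends with a restart in `j` steps
or later. -/
noncomputable def restartProbAfter (f : ℕ → ℕ) (h : History S RestartAction) (j : ℕ) : ℝ≥0∞ :=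
  M.runMeasure h.last {ρ | FirstBadFrom (M.BadAfter f h ρ) j}

lemma measurableSet_firstBadFrom_badAfter (f : ℕ → ℕ) (j : ℕ) :
    MeasurableSet {ρ | FirstBadFrom (M.BadAfter f h ρ) j} :=
  measurableSet_firstBadFrom
    (fun _ => measurable_prepend (phaseStates h) (M.decidedBy_badAt _ _).measurableSet) j

variable {h} {f : ℕ → ℕ}

lemma restartProbAfter_zero_of_restart (hr : M.nextAction f h = .restart) :
    M.restartProbAfter f h 0 = 1 := by
  refine (mem_ae_iff_prob_eq_one (M.measurableSet_firstBadFrom_badAfter h f 0)).1 ?_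
  filter_upwards [M.ae_zero_eq h.last] with ρ hρ
  exact firstBadFrom_zero.2 ⟨0, (M.nextAction_eq_restart_iff h f hρ).1 hr⟩

lemma restartProbAfter_succ_of_restart (hr : M.nextAction f h = .restart) (j : ℕ) :
    M.restartProbAfter f h (j + 1) = 0 := by
  refine measure_eq_zero_iff_ae_notMem.2 ?_
  filter_upwards [M.ae_zero_eq h.last] with ρ hρ
  exact not_firstBadFrom_succ ((M.nextAction_eq_restart_iff h f hρ).1 hr) j

lemma restartProbAfter_zero_of_cont (hc : M.nextAction f h = .cont) :
    M.restartProbAfter f h 0 =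
      ∑' s, M.step h.last s * M.restartProbAfter f (extend h .cont s) 0 := by
  rw [restartProbAfter, M.runMeasure_apply _ (M.measurableSet_firstBadFrom_badAfter h f 0)]
  refine tsum_congr fun s => congrArg (_ * M.runMeasure s ·) (Set.ext fun ρ => ?_)
  simp only [Set.mem_preimage, Set.mem_ofPred_eq, firstBadFrom_zero, badAfter_extend_cont]
  exact exists_iff_exists_succ (M.not_badAfter_zero_of_cont hc ρ)

lemma restartProbAfter_succ_of_cont (hc : M.nextAction f h = .cont) (j : ℕ) :
    M.restartProbAfter f h (j + 1) =
      ∑' s, M.step h.last s * M.restartProbAfter f (extend h .cont s) j := by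
  rw [restartProbAfter, M.runMeasure_apply _ (M.measurableSet_firstBadFrom_badAfter h f _)]
  refine tsum_congr fun s => congrArg (_ * M.runMeasure s ·) (Set.ext fun ρ => ?_)
  simp only [Set.mem_preimage, Set.mem_ofPred_eq, badAfter_extend_cont]
  exact firstBadFrom_succ_iff (M.not_badAfter_zero_of_cont hc ρ)

lemma restartProbAfter_extend_restart (f : ℕ → ℕ) (h : History S RestartAction) (j : ℕ) :
    M.restartProbAfter f (extend h .restart M.init) j =
      M.restartProb (f (phaseNumber h + 1)) j := by
  simp only [restartProbAfter, restartProb, badAfter_extend_restart, extend_last]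

/-- A bound on the expected number of further steps after the history `h`, if `Val n` is one for
the run from the beginning of phase `n` on. -/
noncomputable def potential (f : ℕ → ℕ) (Val : ℕ → ℝ≥0∞) (h : History S RestartAction) : ℝ≥0∞ :=
  ∑' j, M.restartProbAfter f h j + M.restartProbAfter f h 0 * Val (phaseNumber h + 1)

variable {Val : ℕ → ℝ≥0∞}

lemma potential_step_of_restart
    (hVal : ∀ n, 1 ≤ n → M.phaseCost (f n) + M.restartProb (f n) 0 * Val (n + 1) ≤ Val n)
    (hr : M.nextAction f h = .restart) :
    M.restartProbAfter f h 0 + M.potential f Val (extend h .restart M.init) ≤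
      M.potential f Val h := by
  have hnext : M.potential f Val (extend h .restart M.init) ≤ Val (phaseNumber h + 1) := by
    simp only [potential, restartProbAfter_extend_restart, phaseNumber_extend_restart]
    exact hVal _ (Nat.le_add_left 1 _)
  have hcost : ∑' j, M.restartProbAfter f h j = 1 := by
    rw [tsum_eq_zero_add' ENNReal.summable]
    simp [M.restartProbAfter_zero_of_restart hr, M.restartProbAfter_succ_of_restart hr]
  rw [potential.eq_def M f Val h, hcost, M.restartProbAfter_zero_of_restart hr, one_mul]
  gcongr

lemma potential_step_of_cont (hc : M.nextAction f h = .cont) :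
    M.restartProbAfter f h 0 + ∑' s, M.step h.last s * M.potential f Val (extend h .cont s) =
      M.potential f Val h := by
  rw [potential, tsum_eq_zero_add' ENNReal.summable, add_assoc]
  simp only [M.restartProbAfter_succ_of_cont hc, potential, mul_add, ENNReal.tsum_add,
    phaseNumber_extend_cont, ← mul_assoc, ENNReal.tsum_mul_right,
    ← M.restartProbAfter_zero_of_cont hc]
  rw [ENNReal.tsum_comm]
  simp only [ENNReal.tsum_mul_left]

lemma potential_init (f : ℕ → ℕ) (Val : ℕ → ℝ≥0∞) :
    M.potential f Val ⟨[], M.init⟩ = M.phaseCost (f 1) + M.restartProb (f 1) 0 * Val 2 := by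
  have hbad (ρ : ℕ → S) : M.BadAfter f ⟨[], M.init⟩ ρ = M.BadAt (f 1) ρ := by
    ext t
    simp [BadAfter, phaseStates, phaseNumber, prepend, List.rtakeWhile]
  simp [potential, restartProbAfter, hbad, phaseNumber, phaseCost, restartProb]

theorem expectedSteps_le
    (hVal : ∀ n, 1 ≤ n → M.phaseCost (f n) + M.restartProb (f n) 0 * Val (n + 1) ≤ Val n) :
    M.expectedSteps f ≤ Val 1 := by
  classical
  refine (lintegral_lastVisit_le (Q := restarted S) (u := fun h => M.restartProbAfter f h 0)
    (V := M.potential f Val) _ (fun h => ?_) (fun h => ?_) _).trans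
    ((M.potential_init f Val).trans_le (hVal 1 le_rfl))
  · cases ha : M.nextAction f h with
    | restart =>
      rw [M.tsum_induced_step_of_restart ha, M.restartProbAfter_zero_of_restart ha,
        if_pos (extend_restart_mem_restarted h _)]
    | cont =>
      rw [M.tsum_induced_step_of_cont ha, M.restartProbAfter_zero_of_cont ha]
      simp only [extend_cont_notMem_restarted, if_false, le_refl]
  · cases ha : M.nextAction f h with
    | restart => exact (M.tsum_induced_step_of_restart ha _).symm ▸
        M.potential_step_of_restart hVal ha
    | cont => exact (M.tsum_induced_step_of_cont ha _).symm ▸ (M.potential_step_of_cont ha).le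

end Phases

section Graph

variable {S O : Type*} (M : POMC S O)

/-- The states in `X` have all their successors in `X`. -/
def IsAbsorbing (X : Set S) : Prop := ∀ s ∈ X, ∀ t, M.Edge s t → t ∈ X

variable {M}

lemma IsAbsorbing.union {X Y : Set S} (hX : M.IsAbsorbing X) (hY : M.IsAbsorbing Y) :
    M.IsAbsorbing (X ∪ Y) :=
  fun s hs t ht => hs.imp (hX s · t ht) (hY s · t ht)

lemma IsAbsorbing.mem_of_reach {X : Set S} (hX : M.IsAbsorbing X) {s t : S} (hs : s ∈ X)
    (hst : M.Reach s t) : t ∈ X := by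
  induction hst with
  | refl => exact hs
  | tail _ he ih => exact hX _ ih _ he

lemma reach_of_edges {ρ : ℕ → S} (hρ : ∀ n, M.Edge (ρ n) (ρ (n + 1))) {i j : ℕ} (hij : i ≤ j) :
    M.Reach (ρ i) (ρ j) := by
  induction j, hij using Nat.le_induction with
  | base => exact .refl
  | succ j _ ih => exact ih.tail (hρ j)

lemma IsAbsorbing.mem_of_le {X : Set S} (hX : M.IsAbsorbing X) {ρ : ℕ → S}
    (hρ : ∀ n, M.Edge (ρ n) (ρ (n + 1))) {i j : ℕ} (hi : ρ i ∈ X) (hij : i ≤ j) : ρ j ∈ X :=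
  hX.mem_of_reach hi (reach_of_edges hρ hij)

lemma IsBSCC.isAbsorbing {B : Set S} (hB : M.IsBSCC B) : M.IsAbsorbing B := hB.2

lemma IsBSCC.reach {B : Set S} (hB : M.IsBSCC B) {s t : S} (hs : s ∈ B) (ht : t ∈ B) :
    M.Reach s t :=
  hB.1.prop.2 s hs t ht

lemma IsBSCC.eq_of_mem {B B' : Set S} (hB : M.IsBSCC B) (hB' : M.IsBSCC B') {s : S} (hs : s ∈ B)
    (hs' : s ∈ B') : B = B' :=
  Set.Subset.antisymm (fun _ ht => hB'.isAbsorbing.mem_of_reach hs' (hB.reach hs ht))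
    fun _ ht => hB.isAbsorbing.mem_of_reach hs (hB'.reach hs' ht)

lemma isBSCC_setOf_reach {t : S} (ht : ∀ u, M.Reach t u → M.Reach u t) :
    M.IsBSCC {u | M.Reach t u} :=
  ⟨⟨⟨⟨t, .refl⟩, fun u hu _ hv => (ht u hu).trans hv⟩, fun _ hB hle _ hu =>
    hB.2 t (hle .refl) _ hu⟩, fun _ hu _ he => hu.tail he⟩

variable (M)

lemma exists_isBSCC_reachable [Finite S] (s : S) :
    ∃ B, M.IsBSCC B ∧ ∃ t ∈ B, M.Reach s t := by
  -- Shrinking the set of reachable states as far as possible yields a bottom component.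
  obtain ⟨t, hst, hmin⟩ := Set.exists_min_image {t | M.Reach s t}
    (fun t => {u | M.Reach t u}.ncard) (Set.toFinite _) ⟨s, .refl⟩
  refine ⟨{u | M.Reach t u}, isBSCC_setOf_reach fun u htu => ?_, t, .refl, hst⟩
  have hsub : {v | M.Reach u v} ⊆ {v | M.Reach t v} := fun v huv => htu.trans huv
  have heq := Set.eq_of_subset_of_ncard_le hsub (hmin u (hst.trans htu)) (Set.toFinite _)
  exact heq.ge (Relation.ReflTransGen.refl : M.Reach t t)

lemma exists_edge (s : S) : ∃ t, M.Edge s t := by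
  obtain ⟨t, ht⟩ := (M.step s).support_nonempty
  exact ⟨t, pos_iff_ne_zero.2 ((PMF.mem_support_iff _ _).1 ht)⟩

lemma exists_path_of_length (s : S) (m : ℕ) : ∃ π : ℕ → S, π 0 = s ∧ M.IsPath π m := by
  choose next hnext using M.exists_edge
  refine ⟨fun n => next^[n] s, rfl, fun n _ => ?_⟩
  simpa only [Function.iterate_succ_apply'] using hnext _

variable {M}

lemma IsPath.mono {π : ℕ → S} {m n : ℕ} (h : M.IsPath π m) (hn : n ≤ m) : M.IsPath π n :=
  fun i hi => h i (hi.trans_le hn)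

lemma IsPath.cons {s : S} {π : ℕ → S} {m : ℕ} (h : M.IsPath π m) (he : M.Edge s (π 0)) :
    M.IsPath (cons s π) (m + 1) := by
  intro n hn
  cases n with
  | zero => exact he
  | succ n => exact h n (by omega)

lemma IsPath.reach {π : ℕ → S} {m : ℕ} (h : M.IsPath π m) : M.Reach (π 0) (π m) := by
  induction m with
  | zero => exact .refl
  | succ m ih => exact (ih (h.mono m.le_succ)).tail (h m m.lt_succ_self)

lemma exists_path_of_reach {s t : S} (h : M.Reach s t) :
    ∃ (π : ℕ → S) (m : ℕ), π 0 = s ∧ π m = t ∧ M.IsPath π m := by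
  induction h using Relation.ReflTransGen.head_induction_on with
  | refl => exact ⟨fun _ => t, 0, rfl, rfl, fun n hn => absurd hn n.not_lt_zero⟩
  | head he _ ih =>
    obtain ⟨π, m, h0, hm, hp⟩ := ih
    exact ⟨POMC.cons _ π, m + 1, rfl, hm, hp.cons (by rwa [h0])⟩

lemma IsPath.exists_extension {π : ℕ → S} {m : ℕ} (h : M.IsPath π m) {t : S}
    (ht : M.Reach (π m) t) : ∃ (π' : ℕ → S) (m' : ℕ), m ≤ m' ∧ M.IsPath π' m' ∧
      (∀ i ≤ m, π' i = π i) ∧ π' m' = t := by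
  obtain ⟨σ, l, h0, hl, hσ⟩ := exists_path_of_reach ht
  have hle (i : ℕ) (hi : i ≤ m) : (if i ≤ m then π i else σ (i - m)) = π i := if_pos hi
  have hge (i : ℕ) : (if m + i ≤ m then π (m + i) else σ (m + i - m)) = σ i := by
    rcases i.eq_zero_or_pos with rfl | hi
    · simp [h0]
    · rw [if_neg (by omega), Nat.add_sub_cancel_left]
  refine ⟨fun i => if i ≤ m then π i else σ (i - m), m + l, by omega, fun n hn => ?_, hle,
    (hge l).trans hl⟩
  rcases lt_or_ge n m with hnm | hnm
  · simpa only [hle n hnm.le, hle (n + 1) hnm] using h n hnm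
  · obtain ⟨i, rfl⟩ := Nat.exists_eq_add_of_le hnm
    simpa only [add_assoc, hge] using hσ i (by omega)

lemma IsBSCC.exists_path_visiting {B : Set S} (hB : M.IsBSCC B) {s : S} (hs : s ∈ B) (v : ℕ)
    (T : Finset S) (hT : ∀ t ∈ T, t ∈ B) : ∃ (π : ℕ → S) (m : ℕ), π 0 = s ∧ v ≤ m ∧
      M.IsPath π m ∧ ∀ t ∈ T, ∃ n, v ≤ n ∧ n ≤ m ∧ π n = t := by
  classical
  induction T using Finset.induction_on with
  | empty =>
    obtain ⟨π, h0, hp⟩ := M.exists_path_of_length s v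
    exact ⟨π, v, h0, le_rfl, hp, by simp⟩
  | insert t T _ ih =>
    obtain ⟨π, m, h0, hm, hp, hvisit⟩ := ih fun u hu => hT u (Finset.mem_insert_of_mem hu)
    have hreach : M.Reach (π m) t :=
      hB.reach (hB.isAbsorbing.mem_of_reach hs (h0 ▸ hp.reach)) (hT t (Finset.mem_insert_self t T))
    obtain ⟨π', m', hmm, hp', heq, hend⟩ := hp.exists_extension hreach
    refine ⟨π', m', (heq 0 m.zero_le).trans h0, hm.trans hmm, hp', fun u hu => ?_⟩
    rcases Finset.mem_insert.1 hu with rfl | hu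
    · exact ⟨m', hm.trans hmm, le_rfl, hend⟩
    · obtain ⟨n, hvn, hn, hu⟩ := hvisit u hu
      exact ⟨n, hvn, hn.trans hmm, (heq n hn).trans hu⟩

lemma exists_le_radius [Finite S] {prog : (ℕ → S) → ℕ → Prop} {X : Set S}
    (h : ∀ s ∈ X, ∃ (π : ℕ → S) (m : ℕ), π 0 = s ∧ prog π m) {s : S} (hs : s ∈ X) :
    ∃ m ≤ radius prog X, ∃ π : ℕ → S, π 0 = s ∧ prog π m := by
  have hne : {m | ∃ π : ℕ → S, π 0 = s ∧ prog π m}.Nonempty := by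
    obtain ⟨π, m, hπ⟩ := h s hs
    exact ⟨m, π, hπ⟩
  exact ⟨_, le_csSup ((Set.toFinite X).image _).bddAbove (Set.mem_image_of_mem _ hs),
    Nat.sInf_mem hne⟩

end Graph

section Absorption

variable {S O : Type*}

/-- The runs that visit the set `Z`. -/
def reaches (Z : Set S) : Set (ℕ → S) := {ρ | ∃ n, ρ n ∈ Z}

lemma measurableSet_reaches [MeasurableSpace S] [DiscreteMeasurableSpace S] (Z : Set S) :
    MeasurableSet (reaches Z) := by
  rw [reaches, Set.ofPred_exists]
  exact .iUnion fun n => measurableSet_apply_mem n Z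

variable [Countable S] [MeasurableSpace S] [DiscreteMeasurableSpace S] {M : POMC S O} {Z : Set S}
  {R : ℕ} {ε : ℝ≥0∞}

lemma IsAbsorbing.ae_mem (hZ : M.IsAbsorbing Z) {s : S} (hs : s ∈ Z) (n : ℕ) :
    ∀ᵐ ρ ∂M.runMeasure s, ρ n ∈ Z := by
  filter_upwards [M.ae_isPath s, M.ae_zero_eq s] with ρ hρ h0
  exact hZ.mem_of_le hρ (by rwa [h0]) n.zero_le

lemma runMeasure_reaches_of_notMem_canReach {s : S} (hs : s ∉ M.canReach Z) :
    M.runMeasure s (reaches Z) = 0 := by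
  refine measure_eq_zero_iff_ae_notMem.2 ?_
  filter_upwards [M.ae_isPath s, M.ae_zero_eq s] with ρ hρ h0
  rintro ⟨n, hn⟩
  exact hs ⟨ρ n, hn, h0 ▸ reach_of_edges hρ n.zero_le⟩

lemma IsAbsorbing.runMeasure_notMem_mul_le (hZ : M.IsAbsorbing Z)
    (h : ∀ s, M.runMeasure s {ρ | ρ R ∈ Zᶜ} ≤ ε) (j : ℕ) (s : S) :
    M.runMeasure s {ρ | ρ (j * R) ∈ Zᶜ} ≤ ε ^ j := by
  refine (measure_mono_ae ?_).trans (M.runMeasure_iterate_le (decidedBy_apply_mem R Zᶜ) h j s)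
  filter_upwards [M.ae_isPath s] with ρ hρ hmem i hi hZi
  exact hmem (hZ.mem_of_le hρ hZi ((Nat.succ_mul i R).symm.trans_le (Nat.mul_le_mul_right R hi)))

lemma IsAbsorbing.runMeasure_late_step_le (hZ : M.IsAbsorbing Z)
    (h : ∀ s ∈ M.canReach Z \ Z, M.runMeasure s {ρ | ρ R ∈ Zᶜ} ≤ ε) (s : S) :
    M.runMeasure s ({ρ | ρ R ∈ Zᶜ} ∩ reaches Z) ≤ ε * M.runMeasure s (reaches Z) := by
  set late : Set (ℕ → S) := {ρ | ρ R ∈ Zᶜ} with hlate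
  have hmeas : MeasurableSet late := measurableSet_apply_mem R Zᶜ
  by_cases hs : s ∈ M.canReach Z
  swap
  · rw [measure_mono_null Set.inter_subset_right (runMeasure_reaches_of_notMem_canReach hs)]
    exact zero_le
  by_cases hsZ : s ∈ Z
  · have hnull : M.runMeasure s late = 0 := by
      simpa [hlate, ae_iff] using hZ.ae_mem hsZ R
    rw [measure_mono_null Set.inter_subset_left hnull]
    exact zero_le
  set μ := M.runMeasure s
  have hsplit : μ (reaches Z) = μ lateᶜ + μ (late ∩ reaches Z) := by
    rw [← measure_inter_add_sdiff (reaches Z) hmeas, add_comm, Set.inter_comm late,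
      Set.sdiff_eq, Set.inter_eq_right.2]
    exact fun ρ hρ => ⟨R, not_not.1 hρ⟩
  calc μ (late ∩ reaches Z)
      = μ (late ∩ reaches Z) * (μ late + μ lateᶜ) := by
        rw [measure_add_measure_compl hmeas, measure_univ, mul_one]
    _ = μ late * μ (late ∩ reaches Z) + μ (late ∩ reaches Z) * μ lateᶜ := by ring
    _ ≤ ε * μ (late ∩ reaches Z) + ε * μ lateᶜ := by
        gcongr
        · exact h s ⟨hs, hsZ⟩
        · exact (measure_mono Set.inter_subset_left).trans (h s ⟨hs, hsZ⟩)
    _ = ε * μ (reaches Z) := by rw [hsplit]; ring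

lemma IsAbsorbing.runMeasure_late_le (hZ : M.IsAbsorbing Z)
    (h : ∀ s ∈ M.canReach Z \ Z, M.runMeasure s {ρ | ρ R ∈ Zᶜ} ≤ ε) (j : ℕ) (s : S) :
    M.runMeasure s ({ρ | ρ (j * R) ∈ Zᶜ} ∩ reaches Z) ≤ ε ^ j * M.runMeasure s (reaches Z) := by
  induction j generalizing s with
  | zero => simpa using measure_mono Set.inter_subset_right
  | succ j ih =>
    set late : ℕ → Set (ℕ → S) := fun n => {ρ | ρ n ∈ Zᶜ}
    have hdec : DecidedBy R (late R) := decidedBy_apply_mem R Zᶜ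
    have hmeas : MeasurableSet (late (j * R) ∩ reaches Z) :=
      (measurableSet_apply_mem _ _).inter (measurableSet_reaches Z)
    calc M.runMeasure s (late ((j + 1) * R) ∩ reaches Z)
        ≤ M.runMeasure s (late R ∩ shift R ⁻¹' (late (j * R) ∩ reaches Z)) := by
          refine measure_mono_ae ?_
          filter_upwards [M.ae_isPath s] with ρ hρ ⟨hlate, n, hn⟩
          rw [add_mul, one_mul, add_comm] at hlate
          have hRn : R ≤ n := not_lt.1 fun hnR => hlate (hZ.mem_of_le hρ hn (by omega))
          exact ⟨fun hR => hlate (hZ.mem_of_le hρ hR (Nat.le_add_right _ _)), hlate, n - R, by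
            rwa [shift_apply, Nat.add_sub_cancel' hRn]⟩
      _ = ∫⁻ ρ in late R, M.runMeasure (ρ R) (late (j * R) ∩ reaches Z) ∂M.runMeasure s :=
          M.runMeasure_inter_shift s R hdec hmeas
      _ ≤ ∫⁻ ρ in late R, ε ^ j * M.runMeasure (ρ R) (reaches Z) ∂M.runMeasure s :=
          lintegral_mono fun ρ => ih _
      _ = ε ^ j * M.runMeasure s (late R ∩ shift R ⁻¹' reaches Z) := by
          rw [M.runMeasure_inter_shift s R hdec (measurableSet_reaches Z), lintegral_const_mul]
          exact (Measurable.of_discrete (f := fun t => M.runMeasure t (reaches Z))).comp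
            (measurable_pi_apply R)
      _ ≤ ε ^ j * M.runMeasure s (late R ∩ reaches Z) := by
          gcongr
          exact fun ρ ⟨n, hn⟩ => ⟨R + n, hn⟩
      _ ≤ ε ^ j * (ε * M.runMeasure s (reaches Z)) := by
          gcongr
          exact hZ.runMeasure_late_step_le h s
      _ = ε ^ (j + 1) * M.runMeasure s (reaches Z) := by ring

end Absorption

section Progress

variable {S O : Type*} {M : POMC S O} {prog : (ℕ → S) → ℕ → Prop} {X : Set S}

/-- The runs that start in `X` and contain no path of the family `prog` up to time `L`. -/
def stalled (prog : (ℕ → S) → ℕ → Prop) (X : Set S) (L : ℕ) : Set (ℕ → S) :=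
  {ρ | ρ 0 ∈ X ∧ ¬ ∃ a m, a + m ≤ L ∧ prog (shift a ρ) m}

lemma stalled_anti {L L' : ℕ} (h : L ≤ L') : stalled prog X L' ⊆ stalled prog X L :=
  fun _ hρ => ⟨hρ.1, fun ⟨a, m, ham, hp⟩ => hρ.2 ⟨a, m, ham.trans h, hp⟩⟩

lemma IsAbsorbing.shift_mem_stalled (hX : M.IsAbsorbing X) {ρ : ℕ → S}
    (hρ : ∀ n, M.Edge (ρ n) (ρ (n + 1))) {a L L' : ℕ} (h : ρ ∈ stalled prog X L')
    (ha : a + L ≤ L') : shift a ρ ∈ stalled prog X L := by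
  refine ⟨hX.mem_of_le hρ h.1 a.zero_le, ?_⟩
  rintro ⟨b, m, hbm, hp⟩
  exact h.2 ⟨a + b, m, by omega, by rwa [shift_shift] at hp⟩

/-- Whether `π 0, …, π m` is in the family `prog` does not depend on the values of `π` after `m`. -/
def IsLocal (prog : (ℕ → S) → ℕ → Prop) : Prop := ∀ m, DecidedBy m {π | prog π m}

lemma IsLocal.decidedBy_stalled (h : IsLocal prog) (X : Set S) (L : ℕ) :
    DecidedBy L (stalled prog X L) := by
  rintro ρ ρ' hρ ⟨h0, hn⟩
  refine ⟨by rwa [← hρ 0 L.zero_le], fun ⟨a, m, ham, hp⟩ => hn ⟨a, m, ham, ?_⟩⟩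
  exact h m _ _ (fun i hi => (hρ (a + i) (by omega)).symm) hp

variable [Countable S] [MeasurableSpace S] [DiscreteMeasurableSpace S]

lemma prob_le_one (M : POMC S O) (prog : (ℕ → S) → ℕ → Prop) (hX : X.Nonempty) (r : ℕ) :
    M.prob prog X r ≤ 1 := by
  obtain ⟨s, hs⟩ := hX
  exact (iInf₂_le s hs).trans MeasureTheory.prob_le_one

lemma prob_pos [Finite S] (hloc : IsLocal prog) (hpath : ∀ π m, prog π m → M.IsPath π m) {r : ℕ}
    (h : ∀ s ∈ X, ∃ m ≤ r, ∃ π : ℕ → S, π 0 = s ∧ prog π m) : 0 < M.prob prog X r := by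
  classical
  set progress : Set (ℕ → S) := {ρ | ∃ a m, a + m ≤ r ∧ prog (fun n => ρ (a + n)) m}
  have hpos : ∀ s ∈ X, 0 < M.runMeasure s progress := by
    intro s hs
    obtain ⟨m, hm, π, h0, hp⟩ := h s hs
    have hsub : cylinder m π ⊆ progress := fun ρ hρ =>
      ⟨0, m, by omega, hloc m π _ (fun i hi => by rw [zero_add, hρ i hi]) hp⟩
    refine lt_of_lt_of_le ?_ (measure_mono hsub)
    rw [runMeasure_cylinder, if_pos h0, pos_iff_ne_zero, Finset.prod_ne_zero_iff]
    exact fun i hi => (hpath π m hp i (Finset.mem_range.1 hi)).ne'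
  rcases X.eq_empty_or_nonempty with rfl | hne
  · simp [prob]
  · obtain ⟨t, ht, hmin⟩ := Set.exists_min_image X (fun s => M.runMeasure s progress)
      (Set.toFinite _) hne
    exact (hpos t ht).trans_le (le_iInf₂ hmin)

lemma runMeasure_stalled_le (hloc : IsLocal prog) {r R : ℕ} (hr : r ≤ R) {P : ℝ≥0∞}
    (hP : P ≤ M.prob prog X r) (s : S) : M.runMeasure s (stalled prog X R) ≤ 1 - P := by
  by_cases hs : s ∈ X
  · have hprogress : P ≤ M.runMeasure s (stalled prog X R)ᶜ := by
      refine (hP.trans (iInf₂_le s hs)).trans (measure_mono ?_)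
      rintro ρ ⟨a, m, ham, hp⟩ hρ
      exact hρ.2 ⟨a, m, ham.trans hr, hp⟩
    rw [← compl_compl (stalled prog X R),
      prob_compl_eq_one_sub (hloc.decidedBy_stalled X R).measurableSet.compl]
    gcongr
  · have hnull : M.runMeasure s (stalled prog X R) = 0 := by
      refine measure_eq_zero_iff_ae_notMem.2 ?_
      filter_upwards [M.ae_zero_eq s] with ρ h0 hρ
      exact hs (h0 ▸ hρ.1)
    rw [hnull]
    exact zero_le

lemma IsAbsorbing.runMeasure_stalled_mul_le (hX : M.IsAbsorbing X) (hloc : IsLocal prog) {r R : ℕ}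
    (hr : r ≤ R) {P : ℝ≥0∞} (hP : P ≤ M.prob prog X r) (j : ℕ) (s : S) :
    M.runMeasure s (stalled prog X (j * R)) ≤ (1 - P) ^ j := by
  refine (measure_mono_ae ?_).trans (M.runMeasure_iterate_le (hloc.decidedBy_stalled X R)
    (runMeasure_stalled_le hloc hr hP) j s)
  filter_upwards [M.ae_isPath s] with ρ hρ hmem i hi
  exact hX.shift_mem_stalled hρ hmem ((Nat.succ_mul i R).symm.trans_le (Nat.mul_le_mul_right R hi))

lemma IsAbsorbing.runMeasure_notMem_le {Z : Set S} (hZ : M.IsAbsorbing Z) (hloc : IsLocal prog)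
    (hend : ∀ π m, prog π m → π m ∈ Z) {r R : ℕ} (hr : r ≤ R) {P : ℝ≥0∞}
    (hP : P ≤ M.prob prog X r) {s : S} (hs : s ∈ X) :
    M.runMeasure s {ρ | ρ R ∈ Zᶜ} ≤ 1 - P := by
  refine (measure_mono_ae ?_).trans (runMeasure_stalled_le hloc hr hP s)
  filter_upwards [M.ae_isPath s, M.ae_zero_eq s] with ρ hρ h0 hR
  refine ⟨by rwa [h0], ?_⟩
  rintro ⟨a, m, ham, hp⟩
  have hm : ρ (a + m) ∈ Z := hend (shift a ρ) m hp
  exact hR (hZ.mem_of_le hρ hm ham)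

end Progress

section Markers

variable {k : ℕ} {S : Type*} (M : POMC S (Set (Marker k))) (v : ℕ)

lemma isLocal_goodProgress : IsLocal M.GoodProgress := by
  rintro m π π' h ⟨hm, hp, hd⟩
  refine ⟨hm, fun n hn => ?_, ?_⟩
  · rw [← h n (by omega), ← h (n + 1) (by omega)]
    exact hp n hn
  · rwa [← h 0 (by omega), ← h m le_rfl]

lemma isLocal_badProgress : IsLocal (M.BadProgress v) := by
  rintro m π π' h ⟨hm, hp, hd⟩
  refine ⟨hm, fun n hn => ?_, ?_⟩
  · rw [← h n (by omega), ← h (n + 1) (by omega)]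
    exact hp n hn
  · rw [← h 0 (by omega), ← h m le_rfl]
    refine hd.imp_right fun ⟨B, hB, h0, hbad, hvisit⟩ => ⟨B, hB, h0, hbad, fun i hi => ?_⟩
    obtain ⟨n, hvn, hn, hf⟩ := hvisit i hi
    exact ⟨n, hvn, hn, h n hn ▸ hf⟩

lemma isAbsorbing_goodBottom : M.IsAbsorbing M.goodBottom :=
  fun s ⟨B, hB, hs, hg⟩ t ht => ⟨B, hB, hB.isAbsorbing s hs t ht, hg⟩

lemma isAbsorbing_badBottom : M.IsAbsorbing M.badBottom :=
  fun s ⟨B, hB, hs, hb⟩ t ht => ⟨B, hB, hB.isAbsorbing s hs t ht, hb⟩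

lemma mem_canReach_good_or_bad [Finite S] (s : S) :
    s ∈ M.canReach M.goodBottom ∨ s ∈ M.canReach M.badBottom := by
  obtain ⟨B, hB, t, ht, hst⟩ := M.exists_isBSCC_reachable s
  by_cases hg : ∃ i, M.IsGoodFor i B
  · exact .inl ⟨t, ⟨B, hB, ht, hg⟩, hst⟩
  · exact .inr ⟨t, ⟨B, hB, ht, hg⟩, hst⟩

variable {M v}

lemma GoodProgress.end_mem {π : ℕ → S} {m : ℕ} (h : M.GoodProgress π m) : π m ∈ M.goodBottom := by
  obtain ⟨-, hp, h | ⟨B, i, hB, h0, hi, -⟩⟩ := h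
  · exact h.2
  · exact ⟨B, hB, hB.isAbsorbing.mem_of_reach h0 hp.reach, i, hi⟩

lemma BadProgress.end_mem {π : ℕ → S} {m : ℕ} (h : M.BadProgress v π m) : π m ∈ M.badBottom := by
  obtain ⟨-, hp, h | ⟨B, hB, h0, hbad, -⟩⟩ := h
  · exact h.2
  · exact ⟨B, hB, hB.isAbsorbing.mem_of_reach h0 hp.reach, hbad⟩

lemma exists_path_of_mem_canReach {X : Set S} {s : S} (hs : s ∈ M.canReach X \ X) :
    ∃ (π : ℕ → S) (m : ℕ), π 0 = s ∧ 0 < m ∧ M.IsPath π m ∧ π m ∈ X := by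
  obtain ⟨⟨t, ht, hst⟩, hX⟩ := hs
  obtain ⟨π, m, h0, hm, hp⟩ := exists_path_of_reach hst
  refine ⟨π, m, h0, Nat.pos_of_ne_zero ?_, hp, hm ▸ ht⟩
  rintro rfl
  exact hX (h0 ▸ hm ▸ ht)

lemma exists_goodProgress_of_transient {s : S} (hs : s ∈ M.canReach M.goodBottom \ M.goodBottom) :
    ∃ (π : ℕ → S) (m : ℕ), π 0 = s ∧ M.GoodProgress π m := by
  obtain ⟨π, m, h0, hm, hp, h⟩ := exists_path_of_mem_canReach hs
  exact ⟨π, m, h0, hm, hp, .inl ⟨h0 ▸ hs, h⟩⟩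

lemma exists_badProgress_of_transient {s : S} (hs : s ∈ M.canReach M.badBottom \ M.badBottom) :
    ∃ (π : ℕ → S) (m : ℕ), π 0 = s ∧ M.BadProgress v π m := by
  obtain ⟨π, m, h0, hm, hp, h⟩ := exists_path_of_mem_canReach hs
  exact ⟨π, m, h0, hm, hp, .inl ⟨h0 ▸ hs, h⟩⟩

lemma exists_goodProgress_of_bottom {s : S} (hs : s ∈ M.goodBottom) :
    ∃ (π : ℕ → S) (m : ℕ), π 0 = s ∧ M.GoodProgress π m := by
  obtain ⟨B, hB, hsB, i, hi⟩ := hs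
  obtain ⟨t, ht, hti⟩ := hi.1
  obtain ⟨π, m, h0, -, hp, hvisit⟩ := hB.exists_path_visiting hsB 1 {t} (by simpa)
  obtain ⟨n, hn, hnm, hnt⟩ := hvisit t (Finset.mem_singleton_self t)
  exact ⟨π, n, h0, hn, hp.mono hnm, .inr ⟨B, i, hB, h0 ▸ hsB, hi, hnt ▸ hti⟩⟩

lemma exists_badProgress_of_bottom [Finite S] {s : S} (hs : s ∈ M.badBottom) :
    ∃ (π : ℕ → S) (m : ℕ), π 0 = s ∧ M.BadProgress v π m := by
  obtain ⟨B, hB, hsB, hbad⟩ := hs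
  obtain ⟨π, m, h0, hm, hp, hvisit⟩ :=
    hB.exists_path_visiting hsB (v + 1) (Set.toFinite B).toFinset (by simp)
  refine ⟨π, m, h0, by omega, hp, .inr ⟨B, hB, h0 ▸ hsB, hbad, fun i hi => ?_⟩⟩
  have hf : ∃ t ∈ B, Marker.f i ∈ M.obs t := by
    by_contra! hcon
    exact hbad ⟨i, hi, hcon⟩
  obtain ⟨t, ht, hft⟩ := hf
  obtain ⟨n, hvn, hnm, hnt⟩ := hvisit t (by simpa)
  exact ⟨n, by omega, hnm, hnt ▸ hft⟩

variable (M v) [Finite S]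

lemma Rm_pos : 0 < M.Rm v := by
  rcases M.mem_canReach_good_or_bad M.init with ⟨t, ht, -⟩ | ⟨t, ht, -⟩
  · obtain ⟨m, hm, π, -, h⟩ := exists_le_radius (fun _ => exists_goodProgress_of_bottom) ht
    exact h.1.trans_le (hm.trans ((le_max_right _ _).trans (le_max_left _ _)))
  · obtain ⟨m, hm, π, -, h⟩ :=
      exists_le_radius (fun _ => exists_badProgress_of_bottom (v := v)) ht
    exact h.1.trans_le (hm.trans ((le_max_right _ _).trans (le_max_right _ _)))

variable [MeasurableSpace S] [DiscreteMeasurableSpace S]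

lemma Pm_pos : 0 < M.Pm v := by
  refine lt_min (lt_min ?_ ?_) (lt_min ?_ ?_)
  · exact prob_pos M.isLocal_goodProgress (fun _ _ h => h.2.1) fun s hs =>
      exists_le_radius (fun _ => exists_goodProgress_of_transient) hs
  · exact prob_pos M.isLocal_goodProgress (fun _ _ h => h.2.1) fun s hs =>
      exists_le_radius (fun _ => exists_goodProgress_of_bottom) hs
  · exact prob_pos (M.isLocal_badProgress v) (fun _ _ h => h.2.1) fun s hs =>
      exists_le_radius (fun _ => exists_badProgress_of_transient) hs
  · exact prob_pos (M.isLocal_badProgress v) (fun _ _ h => h.2.1) fun s hs =>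
      exists_le_radius (fun _ => exists_badProgress_of_bottom) hs

lemma Pm_le_one : M.Pm v ≤ 1 := by
  rcases M.mem_canReach_good_or_bad M.init with ⟨t, ht, -⟩ | ⟨t, ht, -⟩
  · exact (min_le_left _ _).trans ((min_le_right _ _).trans (prob_le_one M _ ⟨t, ht⟩ _))
  · exact (min_le_right _ _).trans ((min_le_right _ _).trans (prob_le_one M _ ⟨t, ht⟩ _))

end Markers

lemma one_sub_pow_ceil_inv_le_half {P : ℝ≥0∞} (hP0 : P ≠ 0) (hP1 : P ≤ 1) :
    (1 - P) ^ ⌈P.toReal⁻¹⌉₊ ≤ 2⁻¹ := by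
  have hP : P ≠ ∞ := ne_top_of_le_ne_top ENNReal.one_ne_top hP1
  set x := P.toReal
  have hx0 : 0 < x := ENNReal.toReal_pos hP0 hP
  have hx1 : x ≤ 1 := ENNReal.toReal_mono ENNReal.one_ne_top hP1
  set q := ⌈x⁻¹⌉₊
  have hxq : 1 ≤ x * q := (mul_inv_cancel₀ hx0.ne').symm.trans_le (by gcongr; exact Nat.le_ceil _)
  have hreal : (1 - x) ^ q ≤ 2⁻¹ :=
    calc (1 - x) ^ q ≤ Real.exp (-x) ^ q := by
          gcongr
          exact Real.one_sub_le_exp_neg x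
      _ = Real.exp (-(x * q)) := by rw [← Real.exp_nat_mul]; ring_nf
      _ ≤ Real.exp (-1) := Real.exp_le_exp.2 (by linarith)
      _ ≤ 2⁻¹ := by
          rw [Real.exp_neg]
          gcongr
          linarith [Real.add_one_le_exp (1 : ℝ)]
  rw [← ENNReal.toReal_le_toReal (by finiteness) (by simp), ENNReal.toReal_pow,
    ENNReal.toReal_sub_of_le hP1 ENNReal.one_ne_top]
  simpa using hreal

lemma eq_zero_of_forall_le_half_pow {x : ℝ≥0∞} (h : ∀ j : ℕ, x ≤ 2⁻¹ ^ j) : x = 0 :=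
  le_antisymm (ge_of_tendsto' (ENNReal.tendsto_pow_atTop_nhds_zero_of_lt_one
    (ENNReal.inv_lt_one.2 ENNReal.one_lt_two)) h) zero_le

section Windows

variable {k : ℕ} {S : Type*} [Finite S] [MeasurableSpace S] [DiscreteMeasurableSpace S]
  (M : POMC S (Set (Marker k))) (v : ℕ)

/-- A multiple of the progress radius: the probability that no progress is made in a window of this
length is at most `1 / 2`. -/
noncomputable def window : ℕ := M.Rm v * ⌈(M.Pm v).toReal⁻¹⌉₊

lemma mul_window (j : ℕ) : j * M.window v = j * ⌈(M.Pm v).toReal⁻¹⌉₊ * M.Rm v := by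
  rw [window, mul_comm (M.Rm v), mul_assoc]

lemma one_sub_Pm_pow_mul_le (j : ℕ) :
    (1 - M.Pm v) ^ (j * ⌈(M.Pm v).toReal⁻¹⌉₊) ≤ 2⁻¹ ^ j := by
  rw [mul_comm, pow_mul]
  gcongr
  exact one_sub_pow_ceil_inv_le_half (M.Pm_pos v).ne' (M.Pm_le_one v)

lemma runMeasure_stalled_good_le (j : ℕ) (s : S) :
    M.runMeasure s (stalled M.GoodProgress M.goodBottom (j * M.window v)) ≤ 2⁻¹ ^ j := by
  rw [mul_window]
  exact (M.isAbsorbing_goodBottom.runMeasure_stalled_mul_le M.isLocal_goodProgress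
    ((le_max_right _ _).trans (le_max_left _ _)) ((min_le_left _ _).trans (min_le_right _ _))
    _ s).trans (M.one_sub_Pm_pow_mul_le v j)

lemma runMeasure_stalled_bad_le (j : ℕ) (s : S) :
    M.runMeasure s (stalled (M.BadProgress v) M.badBottom (j * M.window v)) ≤ 2⁻¹ ^ j := by
  rw [mul_window]
  exact (M.isAbsorbing_badBottom.runMeasure_stalled_mul_le (M.isLocal_badProgress v)
    ((le_max_right _ _).trans (le_max_right _ _)) ((min_le_right _ _).trans (min_le_right _ _))
    _ s).trans (M.one_sub_Pm_pow_mul_le v j)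

variable {M}

lemma runMeasure_notMem_goodBottom_le {s : S} (hs : s ∈ M.canReach M.goodBottom \ M.goodBottom) :
    M.runMeasure s {ρ | ρ (M.Rm v) ∈ M.goodBottomᶜ} ≤ 1 - M.Pm v :=
  M.isAbsorbing_goodBottom.runMeasure_notMem_le M.isLocal_goodProgress (fun _ _ => (·.end_mem))
    ((le_max_left _ _).trans (le_max_left _ _)) ((min_le_left _ _).trans (min_le_left _ _)) hs

lemma runMeasure_notMem_badBottom_le {s : S} (hs : s ∈ M.canReach M.badBottom \ M.badBottom) :
    M.runMeasure s {ρ | ρ (M.Rm v) ∈ M.badBottomᶜ} ≤ 1 - M.Pm v :=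
  M.isAbsorbing_badBottom.runMeasure_notMem_le (M.isLocal_badProgress v) (fun _ _ => (·.end_mem))
    ((le_max_left _ _).trans (le_max_right _ _)) ((min_le_right _ _).trans (min_le_left _ _)) hs

variable (M)

lemma runMeasure_notMem_bottom_step_le (s : S) :
    M.runMeasure s {ρ | ρ (M.Rm v) ∈ (M.goodBottom ∪ M.badBottom)ᶜ} ≤ 1 - M.Pm v := by
  by_cases hs : s ∈ M.goodBottom ∪ M.badBottom
  · have hnull : M.runMeasure s {ρ | ρ (M.Rm v) ∈ (M.goodBottom ∪ M.badBottom)ᶜ} = 0 := by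
      simpa [ae_iff] using
        (M.isAbsorbing_goodBottom.union M.isAbsorbing_badBottom).ae_mem hs (M.Rm v)
    rw [hnull]
    exact zero_le
  · rw [Set.mem_union, not_or] at hs
    rcases M.mem_canReach_good_or_bad s with h | h
    · refine (measure_mono ?_).trans (runMeasure_notMem_goodBottom_le v ⟨h, hs.1⟩)
      exact fun ρ hρ h' => hρ (.inl h')
    · refine (measure_mono ?_).trans (runMeasure_notMem_badBottom_le v ⟨h, hs.2⟩)
      exact fun ρ hρ h' => hρ (.inr h')

lemma runMeasure_notMem_bottom_le (j : ℕ) (s : S) :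
    M.runMeasure s {ρ | ρ (j * M.window v) ∈ (M.goodBottom ∪ M.badBottom)ᶜ} ≤ 2⁻¹ ^ j := by
  rw [mul_window]
  exact ((M.isAbsorbing_goodBottom.union M.isAbsorbing_badBottom).runMeasure_notMem_mul_le
    (M.runMeasure_notMem_bottom_step_le v) _ s).trans (M.one_sub_Pm_pow_mul_le v j)

lemma runMeasure_late_good_le (j : ℕ) (s : S) :
    M.runMeasure s ({ρ | ρ (j * M.window v) ∈ M.goodBottomᶜ} ∩ reaches M.goodBottom) ≤
      2⁻¹ ^ j * M.runMeasure s (reaches M.goodBottom) := by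
  rw [mul_window]
  exact (M.isAbsorbing_goodBottom.runMeasure_late_le
    (fun _ => runMeasure_notMem_goodBottom_le v) _ s).trans
    (mul_le_mul_left (M.one_sub_Pm_pow_mul_le v j) _)

lemma ae_exists_mem_bottom : ∀ᵐ ρ ∂M.runMeasure M.init, ∃ n, ρ n ∈ M.goodBottom ∪ M.badBottom := by
  refine ae_iff.2 (eq_zero_of_forall_le_half_pow fun j => ?_)
  refine (measure_mono ?_).trans (M.runMeasure_notMem_bottom_le 0 j M.init)
  exact fun ρ hρ h => hρ ⟨_, h⟩

lemma ae_exists_shift_notMem_stalled_bad :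
    ∀ᵐ ρ ∂M.runMeasure M.init, ∀ D, ∃ L, shift D ρ ∉ stalled (M.BadProgress 0) M.badBottom L := by
  refine ae_all_iff.2 fun D => ae_iff.2 (eq_zero_of_forall_le_half_pow fun j => ?_)
  refine (measure_mono fun ρ hρ => ?_).trans (M.runMeasure_shift_le M.init D
    ((M.isLocal_badProgress 0).decidedBy_stalled _ _).measurableSet
    (M.runMeasure_stalled_bad_le 0 j))
  exact not_not.1 (not_exists.1 hρ _)

/-- In a bad component the markers `f_i` almost surely keep appearing for every `i` such that `e_i`
does. -/
lemma Pgood_le : M.Pgood ≤ M.runMeasure M.init (reaches M.goodBottom) := by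
  refine measure_mono_ae ?_
  filter_upwards [M.ae_exists_mem_bottom, M.ae_exists_shift_notMem_stalled_bad,
    M.ae_isPath M.init] with ρ ⟨n, hn⟩ hstall hρ ⟨l, hinf, hfin⟩
  refine hn.elim (⟨n, ·⟩) fun hbad => ?_
  obtain ⟨last, hlast⟩ := hfin.bddAbove
  set D := max n (last + 1)
  have hmem (j : ℕ) (hj : D ≤ j) : ρ j ∈ M.badBottom :=
    M.isAbsorbing_badBottom.mem_of_le hρ hbad ((le_max_left _ _).trans hj)
  obtain ⟨L, hL⟩ := hstall D
  refine absurd ⟨hmem D le_rfl, ?_⟩ hL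
  rintro ⟨a, m, -, -, -, h | ⟨B, hB, h0, -, hvisit⟩⟩
  · exact h.1.2 (by simpa using hmem (D + a) (Nat.le_add_right D a))
  · rw [shift_shift] at h0 hvisit
    obtain ⟨u, hu, hDu⟩ := hinf.exists_gt (D + a)
    obtain ⟨i, -, -, hi⟩ := hvisit l ⟨ρ u, hB.isAbsorbing.mem_of_le hρ h0 hDu.le, hu⟩
    have := hlast (show D + a + i ∈ _ from hi)
    omega

end Windows

section GoodWindow

lemma secondHalf_map_range {k : ℕ} (g : ℕ → Set (Marker k)) (n : ℕ) :
    secondHalf ((List.range (2 * n + 1)).map g) = (List.range' n (n + 1)).map g := by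
  rw [secondHalf, List.length_map, List.length_range, ← List.map_drop, List.range_eq_range',
    List.drop_range']
  congr 2 <;> omega

variable {k : ℕ} {S : Type*} (M : POMC S (Set (Marker k)))

/-- The second half of the path `ρ 0, …, ρ (2 * n)` is good. -/
def GoodWindow (ρ : ℕ → S) (n : ℕ) : Prop :=
  ∃ l, n = 0 ∨ ((∃ u, n ≤ u ∧ u ≤ 2 * n ∧ Marker.e l ∈ M.obs (ρ u)) ∧
    ∀ u, n ≤ u → u ≤ 2 * n → Marker.f l ∉ M.obs (ρ u))

lemma goodPath_secondHalf_iff (ρ : ℕ → S) (n : ℕ) :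
    GoodPath (secondHalf ((List.range (2 * n + 1)).map fun i => M.obs (ρ i))) ↔
      M.GoodWindow ρ n := by
  have hrange (u : ℕ) : n ≤ u ∧ u < n + (n + 1) ↔ n ≤ u ∧ u ≤ 2 * n := by omega
  simp only [GoodPath, GoodWindow, secondHalf_map_range, List.forall_mem_map]
  simp only [List.length_map, List.length_range', add_le_iff_nonpos_left, nonpos_iff_eq_zero,
    List.mem_map, exists_exists_and_eq_and, List.mem_range'_1, hrange]
  simp only [and_assoc, and_imp]

lemma badAt_iff (F : ℕ) (ρ : ℕ → S) (t : ℕ) :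
    M.BadAt F ρ t ↔ ∃ i, t = 2 * (F * i) ∧ ¬ M.GoodWindow ρ (F * i) := by
  constructor
  · rintro ⟨⟨i, rfl⟩, h⟩
    rw [mul_assoc, goodPath_secondHalf_iff] at h
    exact ⟨i, mul_assoc 2 F i, h⟩
  · rintro ⟨i, rfl, h⟩
    exact ⟨⟨i, (mul_assoc 2 F i).symm⟩, by rwa [goodPath_secondHalf_iff]⟩

variable {M}

lemma shift_mem_stalled_of_not_goodWindow {ρ : ℕ → S} (hρ : ∀ n, M.Edge (ρ n) (ρ (n + 1)))
    {D n a L : ℕ} (hD : ρ D ∈ M.goodBottom) (hDn : D ≤ n) (h : ¬ M.GoodWindow ρ n) (hna : n ≤ a)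
    (haL : a + L ≤ 2 * n) : shift a ρ ∈ stalled M.GoodProgress M.goodBottom L := by
  have hgood : ∀ j ≥ D, ρ j ∈ M.goodBottom := fun j => M.isAbsorbing_goodBottom.mem_of_le hρ hD
  obtain ⟨C, hC, hDC, -⟩ := hD
  refine ⟨hgood a (hDn.trans hna), ?_⟩
  rintro ⟨b, m, hbm, -, -, hp⟩
  rw [shift_shift] at hp
  rcases hp with hp | ⟨B, i, hB, h0, hi, he⟩
  · exact hp.1.2 (hgood (a + b) (by omega))
  · obtain rfl := hB.eq_of_mem hC h0 (hC.isAbsorbing.mem_of_le hρ hDC (j := a + b) (by omega))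
    refine h ⟨i, .inr ⟨⟨a + b + m, by omega, by omega, he⟩, fun u hu _ => ?_⟩⟩
    exact hi.2 _ (hC.isAbsorbing.mem_of_le hρ hDC (hDn.trans hu))

lemma shift_mem_stalled_of_goodWindow {v : ℕ} {ρ : ℕ → S} (hρ : ∀ n, M.Edge (ρ n) (ρ (n + 1)))
    {D n : ℕ} (hD : ρ D ∈ M.badBottom) (hDn : D ≤ n) (hn : 0 < n) (h : M.GoodWindow ρ n) :
    shift n ρ ∈ stalled (M.BadProgress v) M.badBottom n := by
  have hbad : ∀ j ≥ D, ρ j ∈ M.badBottom := fun j => M.isAbsorbing_badBottom.mem_of_le hρ hD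
  obtain ⟨C, hC, hDC, -⟩ := hD
  obtain ⟨l, rfl | ⟨⟨u, hu, -, he⟩, hf⟩⟩ := h
  · exact absurd hn (lt_irrefl 0)
  refine ⟨hbad n hDn, ?_⟩
  rintro ⟨b, m, hbm, -, -, hp⟩
  rw [shift_shift] at hp
  rcases hp with hp | ⟨B, hB, h0, -, hvisit⟩
  · exact hp.1.2 (hbad (n + b) (by omega))
  · obtain rfl := hB.eq_of_mem hC h0 (hC.isAbsorbing.mem_of_le hρ hDC (j := n + b) (by omega))
    obtain ⟨j, -, hj, hfj⟩ := hvisit l ⟨ρ u, hC.isAbsorbing.mem_of_le hρ hDC (hDn.trans hu), he⟩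
    exact hf (n + b + j) (by omega) (by omega) hfj

end GoodWindow

lemma tsum_half_pow_le {j : ℕ} (hj : 1 ≤ j) :
    ∑' m : ℕ, (2⁻¹ : ℝ≥0∞) ^ (j * (m + 1)) ≤ 2 * 2⁻¹ ^ j := by
  calc ∑' m : ℕ, (2⁻¹ : ℝ≥0∞) ^ (j * (m + 1)) ≤ ∑' m : ℕ, 2⁻¹ ^ j * 2⁻¹ ^ m := by
        refine ENNReal.tsum_le_tsum fun m => ?_
        rw [← pow_add]
        refine pow_le_pow_right_of_le_one' (ENNReal.inv_le_one.2 one_le_two) ?_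
        nlinarith
    _ = 2 * 2⁻¹ ^ j := by
        rw [ENNReal.tsum_mul_left, ENNReal.tsum_geometric, ENNReal.one_sub_inv_two, inv_inv,
          mul_comm]

lemma tsum_le_of_antitone_of_geometric {g : ℕ → ℝ≥0∞} (hg : Antitone g) (hg1 : ∀ n, g n ≤ 1)
    {N B : ℕ} (hB : 0 < B) {C : ℝ≥0∞} (hC : ∀ i, g (B * i + N) ≤ C * 2⁻¹ ^ (i + 1)) :
    ∑' n, g n ≤ N + C * B := by
  have : NeZero B := ⟨hB.ne'⟩
  have hhead : ∑ n ∈ Finset.range N, g n ≤ N := by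
    simpa using Finset.sum_le_card_nsmul (Finset.range N) g 1 fun n _ => hg1 n
  have htail : ∑' n, g (n + N) ≤ C * B :=
    calc ∑' n, g (n + N) ≤ ∑' n : ℕ, C * 2⁻¹ ^ (n / B + 1) :=
          ENNReal.tsum_le_tsum fun n =>
            (hg (Nat.add_le_add_right (Nat.mul_div_le n B) N)).trans (hC (n / B))
      _ = ∑' p : ℕ × Fin B, C * 2⁻¹ ^ (p.1 + 1) := (Nat.divModEquiv B).tsum_eq
          fun p : ℕ × Fin B => C * 2⁻¹ ^ (p.1 + 1)
      _ = C * B := by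
          rw [ENNReal.tsum_prod (f := fun (i : ℕ) (_ : Fin B) => C * 2⁻¹ ^ (i + 1))]
          simp only [tsum_fintype, Finset.sum_const, Finset.card_univ, Fintype.card_fin,
            nsmul_eq_mul, ENNReal.tsum_mul_left, ENNReal.tsum_geometric_add_one,
            ENNReal.one_sub_inv_two, inv_inv]
          rw [ENNReal.inv_mul_cancel (by norm_num) (by norm_num), mul_one, mul_comm]
  rw [← ENNReal.summable.sum_add_tsum_nat_add' (k := N)]
  exact add_le_add hhead htail

section PhaseBounds

variable {k : ℕ} {S : Type*}

section Pointwise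

variable {M : POMC S (Set (Marker k))} {v : ℕ} {ρ : ℕ → S} {D F t : ℕ}

lemma exists_shift_mem_stalled_good (hρ : ∀ n, M.Edge (ρ n) (ρ (n + 1)))
    (hg : ρ F ∈ M.goodBottom) (h : M.BadAt F ρ t) :
    ∃ m, shift ((m + 1) * F) ρ ∈ stalled M.GoodProgress M.goodBottom ((m + 1) * F) := by
  obtain ⟨i, -, hi⟩ := (M.badAt_iff F ρ t).1 h
  cases i with
  | zero =>
    obtain ⟨-, -, -, l, -⟩ := hg
    exact absurd ⟨l, .inl (mul_zero F)⟩ hi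
  | succ m =>
    refine ⟨m, shift_mem_stalled_of_not_goodWindow hρ hg (Nat.le_mul_of_pos_right F m.succ_pos) hi
      (mul_comm F _).le ?_⟩
    linarith

lemma exists_shift_mem_stalled_good_of_late (hρ : ∀ n, M.Edge (ρ n) (ρ (n + 1))) (hD : 0 < D)
    (hg : ρ D ∈ M.goodBottom) (ht : 4 * D ≤ t) (h : M.BadAt F ρ t) :
    ∃ m, shift ((m + 3) * D) ρ ∈ stalled M.GoodProgress M.goodBottom ((m + 1) * D) := by
  obtain ⟨i, rfl, hi⟩ := (M.badAt_iff F ρ t).1 h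
  set n := F * i
  obtain ⟨m, hm⟩ : ∃ m, n / D = 2 + m :=
    Nat.exists_eq_add_of_le ((Nat.le_div_iff_mul_le hD).2 (by omega))
  have hle : (2 + m) * D ≤ n := hm ▸ Nat.div_mul_le_self n D
  have hlt : n < (2 + m) * D + D := hm ▸ Nat.lt_div_mul_add hD
  exact ⟨m, shift_mem_stalled_of_not_goodWindow hρ hg (by omega) hi (by linarith) (by linarith)⟩

lemma shift_mem_stalled_bad (hρ : ∀ n, M.Edge (ρ n) (ρ (n + 1))) (hb : ρ D ∈ M.badBottom)
    {n : ℕ} (hDn : D ≤ n) (hn : 0 < n) (hF : F ∣ n) (h : ¬ M.BadAt F ρ (2 * n)) :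
    shift n ρ ∈ stalled (M.BadProgress v) M.badBottom n := by
  obtain ⟨i, rfl⟩ := hF
  refine shift_mem_stalled_of_goodWindow hρ hb hDn hn ?_
  by_contra hwindow
  exact h ((M.badAt_iff F ρ _).2 ⟨i, rfl, hwindow⟩)

lemma FirstBadFrom.cases_of_badAt (hρ : ∀ n, M.Edge (ρ n) (ρ (n + 1)))
    (h : FirstBadFrom (M.BadAt F ρ) (4 * D + 1)) (hD : 0 < D) {n : ℕ} (hF : F ∣ n) (hDn : D ≤ n)
    (hnD : n ≤ 2 * D) :
    ρ D ∈ (M.goodBottom ∪ M.badBottom)ᶜ ∨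
      shift n ρ ∈ stalled (M.BadProgress v) M.badBottom D ∨
      ∃ m, shift ((m + 3) * D) ρ ∈ stalled M.GoodProgress M.goodBottom ((m + 1) * D) := by
  obtain ⟨hearly, t, ht⟩ := h
  by_cases hg : ρ D ∈ M.goodBottom
  · refine .inr (.inr (exists_shift_mem_stalled_good_of_late hρ hD hg ?_ ht))
    by_contra! hlt
    exact hearly t (by omega) ht
  by_cases hb : ρ D ∈ M.badBottom
  · exact .inr (.inl (stalled_anti hDn (shift_mem_stalled_bad hρ hb hDn (by omega) hF
      (hearly _ (by omega)))))
  · exact .inl fun h => h.elim hg hb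

end Pointwise

lemma exists_multiple_mem_Icc {F D : ℕ} (hF : 0 < F) (hFD : F ≤ D) :
    ∃ n, F ∣ n ∧ D ≤ n ∧ n ≤ 2 * D := by
  refine ⟨F * (2 * D / F), dvd_mul_right F _, ?_, Nat.mul_div_le _ _⟩
  have := Nat.lt_mul_div_succ (2 * D) hF
  rw [mul_add_one] at this
  omega

variable [Finite S] [MeasurableSpace S] [DiscreteMeasurableSpace S]
  (M : POMC S (Set (Marker k))) (v : ℕ)

lemma window_pos : 0 < M.window v :=
  Nat.mul_pos (M.Rm_pos v) (Nat.ceil_pos.2 (inv_pos.2 (ENNReal.toReal_pos (M.Pm_pos v).ne'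
    (ne_top_of_le_ne_top ENNReal.one_ne_top (M.Pm_le_one v)))))

lemma measurableSet_iUnion_stalled_good (τ ℓ : ℕ → ℕ) :
    MeasurableSet (⋃ m, shift (τ m) ⁻¹' stalled M.GoodProgress M.goodBottom (ℓ m)) :=
  .iUnion fun _ => measurable_shift _ (M.isLocal_goodProgress.decidedBy_stalled _ _).measurableSet

lemma runMeasure_iUnion_stalled_good_le {j : ℕ} (hj : 1 ≤ j) (τ : ℕ → ℕ) (s : S) :
    M.runMeasure s (⋃ m, shift (τ m) ⁻¹'
      stalled M.GoodProgress M.goodBottom (j * (m + 1) * M.window v)) ≤ 2 * 2⁻¹ ^ j :=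
  (measure_iUnion_le _).trans ((ENNReal.tsum_le_tsum fun _ => M.runMeasure_shift_le s _
    (M.isLocal_goodProgress.decidedBy_stalled _ _).measurableSet
    (M.runMeasure_stalled_good_le v _)).trans (tsum_half_pow_le hj))

lemma restartProb_late_le {F j : ℕ} (hF : 0 < F) (hj : 1 ≤ j) (hFj : F ≤ j * M.window v) :
    M.restartProb F (4 * (j * M.window v) + 1) ≤ 4 * 2⁻¹ ^ j := by
  set D := j * M.window v
  obtain ⟨n, hFn, hDn, hnD⟩ := exists_multiple_mem_Icc hF hFj
  set transient : Set (ℕ → S) := {ρ | ρ D ∈ (M.goodBottom ∪ M.badBottom)ᶜ}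
  set stalledBad := shift n ⁻¹' stalled (M.BadProgress v) M.badBottom D
  set stalledGood := ⋃ m, shift ((m + 3) * D) ⁻¹'
    stalled M.GoodProgress M.goodBottom (j * (m + 1) * M.window v)
  calc M.restartProb F (4 * D + 1)
      ≤ M.runMeasure M.init (transient ∪ (stalledBad ∪ stalledGood)) := by
        refine measure_mono_ae ?_
        filter_upwards [M.ae_isPath M.init] with ρ hρ h
        refine (h.cases_of_badAt hρ (hF.trans_le hFj) hFn hDn hnD).imp_right
          (Or.imp_right fun ⟨m, hm⟩ => Set.mem_iUnion.2 ⟨m, ?_⟩)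
        rwa [mul_right_comm, mul_comm _ (m + 1)]
    _ ≤ 2⁻¹ ^ j + (2⁻¹ ^ j + 2 * 2⁻¹ ^ j) := by
        refine (measure_union_le _ _).trans (add_le_add ?_ ((measure_union_le _ _).trans
          (add_le_add ?_ ?_)))
        · exact M.runMeasure_notMem_bottom_le v j M.init
        · exact M.runMeasure_shift_le M.init n
            ((M.isLocal_badProgress v).decidedBy_stalled _ _).measurableSet
            (M.runMeasure_stalled_bad_le v j)
        · exact M.runMeasure_iUnion_stalled_good_le v hj _ M.init
    _ = 4 * 2⁻¹ ^ j := by ring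

lemma restartProb_antitone (F : ℕ) : Antitone (M.restartProb F) :=
  fun _ _ hij => measure_mono fun _ hρ => FirstBadFrom.anti hρ hij

lemma restartProb_le_one (F j : ℕ) : M.restartProb F j ≤ 1 := MeasureTheory.prob_le_one

lemma phaseCost_le {F : ℕ} (hF : 0 < F) :
    M.phaseCost F ≤ ((4 * F + 21 * M.window v : ℕ) : ℝ≥0∞) := by
  set W := M.window v
  have hW : 0 < W := M.window_pos v
  obtain ⟨j, hj, hFj, hjF⟩ : ∃ j, 1 ≤ j ∧ F ≤ j * W ∧ j * W ≤ F + W := by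
    refine ⟨F / W + 1, Nat.le_add_left 1 _, ?_, ?_⟩ <;> rw [Nat.succ_mul]
    · exact (Nat.lt_div_mul_add hW).le
    · exact Nat.add_le_add_right (Nat.div_mul_le_self F W) W
  have hgeom (i : ℕ) : M.restartProb F (4 * W * i + (4 * (j * W) + 1)) ≤ 4 * 2⁻¹ ^ (i + 1) :=
    calc M.restartProb F (4 * W * i + (4 * (j * W) + 1))
        = M.restartProb F (4 * ((i + j) * W) + 1) := by ring_nf
      _ ≤ 4 * 2⁻¹ ^ (i + j) :=
          M.restartProb_late_le v hF (by omega) (hFj.trans (by gcongr; omega))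
      _ ≤ 4 * 2⁻¹ ^ (i + 1) := by
          gcongr 4 * ?_
          exact pow_le_pow_right_of_le_one' (ENNReal.inv_le_one.2 one_le_two) (by omega)
  calc M.phaseCost F ≤ (4 * (j * W) + 1 : ℕ) + 4 * (4 * W : ℕ) :=
        tsum_le_of_antitone_of_geometric (M.restartProb_antitone F) (M.restartProb_le_one F)
          (by omega) hgeom
    _ = ((4 * (j * W) + 1 + 4 * (4 * W) : ℕ) : ℝ≥0∞) := by push_cast; ring
    _ ≤ _ := Nat.cast_le.2 (by omega)

lemma restartProb_zero_le {F j : ℕ} (hj : 1 ≤ j) (hF : j * M.window v ≤ F) :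
    M.restartProb F 0 ≤ M.runMeasure M.init {ρ | ρ F ∈ M.goodBottom}ᶜ +
      2 * 2⁻¹ ^ j * M.runMeasure M.init {ρ | ρ F ∈ M.goodBottom} := by
  set A : Set (ℕ → S) := {ρ | ρ F ∈ M.goodBottom}
  set stalledGood := ⋃ m, shift (m * F) ⁻¹'
    stalled M.GoodProgress M.goodBottom (j * (m + 1) * M.window v)
  have hsub : ∀ᵐ ρ ∂M.runMeasure M.init,
      FirstBadFrom (M.BadAt F ρ) 0 → ρ ∈ Aᶜ ∪ A ∩ shift F ⁻¹' stalledGood := by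
    filter_upwards [M.ae_isPath M.init] with ρ hρ hbad
    by_cases hg : ρ F ∈ M.goodBottom
    · obtain ⟨t, ht⟩ := firstBadFrom_zero.1 hbad
      obtain ⟨m, hm⟩ := exists_shift_mem_stalled_good hρ hg ht
      refine .inr ⟨hg, Set.mem_iUnion.2 ⟨m, ?_⟩⟩
      rw [Set.mem_preimage, shift_shift, add_comm F, ← Nat.succ_mul]
      refine stalled_anti ?_ hm
      rw [mul_right_comm, mul_comm]
      exact Nat.mul_le_mul_left _ hF
    · exact .inl hg
  refine (measure_mono_ae hsub).trans ((measure_union_le _ _).trans (add_le_add le_rfl ?_))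
  exact M.runMeasure_inter_shift_le _ F (decidedBy_apply_mem F _)
    (M.measurableSet_iUnion_stalled_good _ _) (M.runMeasure_iUnion_stalled_good_le v hj _)

lemma runMeasure_reaches_goodBottom_le {F j : ℕ} (hF : j * M.window v ≤ F) :
    M.runMeasure M.init (reaches M.goodBottom) ≤ M.runMeasure M.init {ρ | ρ F ∈ M.goodBottom} +
      2⁻¹ ^ j * M.runMeasure M.init (reaches M.goodBottom) := by
  refine (measure_mono_ae ?_).trans ((measure_union_le _ _).trans (add_le_add le_rfl
    (M.runMeasure_late_good_le v j M.init)))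
  filter_upwards [M.ae_isPath M.init] with ρ hρ h
  by_cases hg : ρ (j * M.window v) ∈ M.goodBottom
  · exact .inl (M.isAbsorbing_goodBottom.mem_of_le hρ hg hF)
  · exact .inr ⟨hg, h⟩

lemma restartProb_zero_toReal_le {F j : ℕ} (hj : 1 ≤ j) (hF : j * M.window v ≤ F) :
    (M.restartProb F 0).toReal ≤ 1 - M.Pgood.toReal * (1 - 3 * 2⁻¹ ^ j) := by
  set A : Set (ℕ → S) := {ρ | ρ F ∈ M.goodBottom}
  set a := (M.runMeasure M.init).real A
  set r := (M.runMeasure M.init).real (reaches M.goodBottom)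
  set ε : ℝ := 2⁻¹ ^ j
  have hrestart : (M.restartProb F 0).toReal ≤ 1 - a + 2 * ε * a := by
    have h := ENNReal.toReal_mono (by finiteness) (M.restartProb_zero_le v hj hF)
    rw [ENNReal.toReal_add (by finiteness) (by finiteness)] at h
    simpa [-inv_pow, ← measureReal_def,
      probReal_compl_eq_one_sub (measurableSet_apply_mem F _)] using h
  have hreach : r ≤ a + ε * r := by
    have h := ENNReal.toReal_mono (by finiteness) (M.runMeasure_reaches_goodBottom_le v hF)
    rw [ENNReal.toReal_add (by finiteness) (by finiteness)] at h
    simpa [-inv_pow, ← measureReal_def] using h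
  have hgood : M.Pgood.toReal ≤ r := ENNReal.toReal_mono (by finiteness) M.Pgood_le
  have hp0 : 0 ≤ M.Pgood.toReal := ENNReal.toReal_nonneg
  have hε0 : 0 ≤ ε := by positivity
  have hε1 : ε ≤ 2⁻¹ := pow_le_of_le_one (by norm_num) (by norm_num) (by omega)
  have hpa : M.Pgood.toReal * (1 - ε) ≤ a := by nlinarith
  nlinarith [mul_le_mul_of_nonneg_right hpa (show 0 ≤ 1 - 2 * ε by linarith), mul_nonneg hp0
    (mul_nonneg hε0 hε0)]

end PhaseBounds

section Recursion

/-- The total cost from phase `n` on, if phase `m` costs `E m` and is followed by another phase with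
probability `q m`. -/
noncomputable def totalCost (E q : ℕ → ℝ≥0∞) (n : ℕ) : ℝ≥0∞ :=
  ∑' m, (∏ i ∈ Finset.range m, q (n + i)) * E (n + m)

lemma totalCost_eq (E q : ℕ → ℝ≥0∞) (n : ℕ) :
    totalCost E q n = E n + q n * totalCost E q (n + 1) := by
  rw [totalCost, tsum_eq_zero_add' ENNReal.summable, totalCost, ← ENNReal.tsum_mul_left]
  simp only [Finset.range_zero, Finset.prod_empty, one_mul, add_zero]
  congr 1
  refine tsum_congr fun m => ?_
  rw [Finset.prod_range_succ', ← mul_assoc, add_zero, mul_comm (q n)]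
  simp only [add_assoc, add_comm 1]

lemma totalCost_le_add_tsum {E q : ℕ → ℝ≥0∞} {n N : ℕ} {b x : ℝ≥0∞} (hq : ∀ m, q m ≤ 1)
    (hE : ∀ m < N, E (n + m) ≤ b) (hx : ∀ m ≥ N, q (n + m) ≤ x) :
    totalCost E q n ≤ N * b + ∑' l, x ^ l * E (n + (N + l)) := by
  have hprod (m : ℕ) : ∏ i ∈ Finset.range m, q (n + i) ≤ 1 :=
    Finset.prod_le_one' fun i _ => hq _
  have hhead : ∑ m ∈ Finset.range N, (∏ i ∈ Finset.range m, q (n + i)) * E (n + m) ≤ N * b := by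
    simpa using Finset.sum_le_card_nsmul (Finset.range N) _ b fun m hm =>
      (mul_le_of_le_one_left' (hprod m)).trans (hE m (Finset.mem_range.1 hm))
  rw [totalCost, ← ENNReal.summable.sum_add_tsum_nat_add' (k := N)]
  refine add_le_add hhead (ENNReal.tsum_le_tsum fun l => ?_)
  rw [add_comm l N, Finset.prod_range_add]
  gcongr
  calc (∏ i ∈ Finset.range N, q (n + i)) * ∏ i ∈ Finset.range l, q (n + (N + i))
      ≤ 1 * ∏ _i ∈ Finset.range l, x :=
        mul_le_mul' (hprod N) (Finset.prod_le_prod' fun i _ => hx _ (Nat.le_add_right N i))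
    _ = x ^ l := by simp

lemma tsum_pow_mul_add_choose {c : ℕ} {a b x : ℝ} (ha : 0 ≤ a) (hb : 0 ≤ b) (hx0 : 0 ≤ x)
    (hx1 : x < 1) :
    ∑' l : ℕ, ENNReal.ofReal x ^ l * ENNReal.ofReal (a + b * (l + c).choose c) =
      ENNReal.ofReal (a / (1 - x) + b / (1 - x) ^ (c + 1)) := by
  have hnorm : ‖x‖ < 1 := by rwa [Real.norm_of_nonneg hx0]
  have hgeom := (hasSum_geometric_of_lt_one hx0 hx1).mul_left a
  have hchoose := (hasSum_choose_mul_geometric_of_norm_lt_one c hnorm).mul_left b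
  have hsum := hgeom.add hchoose
  rw [div_eq_mul_inv, div_eq_mul_one_div b, ← hsum.tsum_eq,
    ENNReal.ofReal_tsum_of_nonneg (fun l => by positivity) hsum.summable]
  refine tsum_congr fun l => ?_
  rw [← ENNReal.ofReal_pow hx0, ← ENNReal.ofReal_mul (by positivity)]
  ring_nf

lemma one_add_add_pow_le (c N l : ℕ) :
    ((1 + (N + l) : ℕ) : ℝ) ^ c ≤ 2 ^ c * (N ^ c + c ! * (l + c).choose c) :=
  calc ((1 + (N + l) : ℕ) : ℝ) ^ c = ((N : ℝ) + ((l + 1 : ℕ) : ℝ)) ^ c := by push_cast; ring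
    _ ≤ 2 ^ (c - 1) * ((N : ℝ) ^ c + ((l + 1 : ℕ) : ℝ) ^ c) :=
        add_pow_le (by positivity) (by positivity) c
    _ ≤ 2 ^ c * (N ^ c + c ! * (l + c).choose c) := by
        gcongr
        · norm_num
        · omega
        · rw [← Nat.cast_mul, ← Nat.ascFactorial_eq_factorial_mul_choose]
          exact_mod_cast Nat.pow_succ_le_ascFactorial (l + 1) c

lemma totalCost_le {E q : ℕ → ℝ≥0∞} {c N : ℕ} {A x : ℝ} (hx0 : 0 ≤ x) (hx1 : x < 1) (hA : 0 ≤ A)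
    (hN : (N : ℝ) ^ c ≤ A) (hE : ∀ n, 1 ≤ n → E n ≤ ENNReal.ofReal (4 * (n : ℝ) ^ c + 21 * A))
    (hq : ∀ n, q n ≤ 1) (hx : ∀ n, N < n → q n ≤ ENNReal.ofReal x) :
    totalCost E q 1 ≤ ENNReal.ofReal (25 * (N * A) + 25 * 2 ^ c * (A / (1 - x)) +
      25 * 2 ^ c * (c ! / (1 - x) ^ (c + 1))) := by
  have hearly : ∀ m < N, E (1 + m) ≤ ENNReal.ofReal (25 * A) := by
    intro m hm
    refine (hE _ (by omega)).trans (ENNReal.ofReal_le_ofReal ?_)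
    have : ((1 + m : ℕ) : ℝ) ^ c ≤ (N : ℝ) ^ c := by
      gcongr
      omega
    linarith
  have hlate (l : ℕ) : E (1 + (N + l)) ≤
      ENNReal.ofReal (25 * 2 ^ c * A + 25 * 2 ^ c * c ! * (l + c).choose c) := by
    refine (hE _ (by omega)).trans (ENNReal.ofReal_le_ofReal ?_)
    have hpow : ((1 + (N + l) : ℕ) : ℝ) ^ c ≤ 2 ^ c * (A + c ! * (l + c).choose c) :=
      (one_add_add_pow_le c N l).trans (by gcongr)
    have hA2 : A ≤ 2 ^ c * A := le_mul_of_one_le_left hA (one_le_pow₀ one_le_two)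
    have hchoose : 0 ≤ (2 : ℝ) ^ c * (c ! * (l + c).choose c) := by positivity
    linarith
  have : 0 < 1 - x := sub_pos.2 hx1
  calc totalCost E q 1
      ≤ N * ENNReal.ofReal (25 * A) + ∑' l, ENNReal.ofReal x ^ l * E (1 + (N + l)) :=
        totalCost_le_add_tsum hq hearly fun m hm => hx _ (by omega)
    _ ≤ N * ENNReal.ofReal (25 * A) + ∑' l : ℕ, ENNReal.ofReal x ^ l *
          ENNReal.ofReal (25 * 2 ^ c * A + 25 * 2 ^ c * c ! * (l + c).choose c) := by
        gcongr with l
        exact hlate l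
    _ = _ := by
        rw [tsum_pow_mul_add_choose (by positivity) (by positivity) hx0 hx1,
          ← ENNReal.ofReal_natCast, ← ENNReal.ofReal_mul (by positivity),
          ← ENNReal.ofReal_add (by positivity) (by positivity)]
        ring_nf

end Recursion

section Estimates

lemma half_le_one_sub (c : ℕ) : (1 / 2 : ℝ) ≤ 1 - 3 * 2⁻¹ ^ (c + 3) := by
  have hle : (2⁻¹ : ℝ) ^ c ≤ 1 := pow_le_one₀ (by norm_num) (by norm_num)
  rw [pow_add]
  linarith

lemma half_le_one_sub_pow (c : ℕ) : (1 / 2 : ℝ) ≤ (1 - 3 * 2⁻¹ ^ (c + 3)) ^ (c + 1) := by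
  have hc : ((c : ℝ) + 1) * 2⁻¹ ^ c ≤ 1 := by
    rw [inv_pow, ← div_eq_mul_inv, div_le_one (by positivity)]
    exact_mod_cast Nat.lt_two_pow_self (n := c)
  calc (1 / 2 : ℝ) ≤ 1 + ((c + 1 : ℕ) : ℝ) * -(3 * 2⁻¹ ^ (c + 3)) := by
        push_cast
        rw [pow_add]
        linarith
    _ ≤ (1 + -(3 * 2⁻¹ ^ (c + 3))) ^ (c + 1) :=
        one_add_mul_le_pow (by linarith [half_le_one_sub c]) _
    _ = (1 - 3 * 2⁻¹ ^ (c + 3)) ^ (c + 1) := by rw [← sub_eq_add_neg]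

lemma natCast_mul_le_rpow {c N : ℕ} (hc : c ≠ 0) {A : ℝ} (hA : 0 ≤ A) (hN : (N : ℝ) ^ c ≤ A) :
    N * A ≤ A ^ (1 + 1 / (c : ℝ)) := by
  have h : (N : ℝ) ≤ A ^ (1 / (c : ℝ)) := by
    rw [one_div, Real.le_rpow_inv_iff_of_pos (by positivity) hA (by positivity), Real.rpow_natCast]
    exact hN
  rw [Real.rpow_one_add' hA (by positivity), mul_comm]
  gcongr

lemma mul_le_rpow_add_pow {c : ℕ} (hc : c ≠ 0) {a z : ℝ} (ha : 0 ≤ a) (hz : 0 ≤ z) :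
    a * z ≤ a ^ (1 + 1 / (c : ℝ)) + z ^ (c + 1) := by
  rcases le_total a (z ^ c) with h | h
  · calc a * z ≤ z ^ c * z := by gcongr
      _ = z ^ (c + 1) := (pow_succ z c).symm
      _ ≤ _ := le_add_of_nonneg_left (by positivity)
  · have hza : z ≤ a ^ (1 / (c : ℝ)) := by
      rwa [one_div, Real.le_rpow_inv_iff_of_pos hz ha (by positivity), Real.rpow_natCast]
    calc a * z ≤ a * a ^ (1 / (c : ℝ)) := by gcongr
      _ = a ^ (1 + 1 / (c : ℝ)) := (Real.rpow_one_add' ha (by positivity)).symm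
      _ ≤ _ := le_add_of_nonneg_right (by positivity)

lemma natCast_succ_le_factorial_succ (c : ℕ) : (c : ℝ) + 1 ≤ (c + 1)! := by
  exact_mod_cast Nat.self_le_factorial (c + 1)

lemma natCast_mul_le_factorial_mul_rpow {c N : ℕ} (hc : 1 ≤ c) {A a : ℝ} (hA0 : 0 ≤ A)
    (ha : 0 ≤ a) (hA : A ≤ 2 * (c + 3) * a) (hN : (N : ℝ) ^ c ≤ A) :
    N * A ≤ 16 * ((c + 1)! * 2 ^ c * a ^ (1 + 1 / (c : ℝ))) := by
  have hc1 : (1 : ℝ) ≤ c := by exact_mod_cast hc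
  have hpow : (c : ℝ) + 1 ≤ 2 ^ c := by exact_mod_cast Nat.lt_two_pow_self (n := c)
  have hexp : 1 + 1 / (c : ℝ) ≤ 2 := by linarith [(div_le_one (by positivity)).2 hc1]
  calc N * A ≤ A ^ (1 + 1 / (c : ℝ)) := natCast_mul_le_rpow (by omega) hA0 hN
    _ ≤ (2 * (c + 3) * a) ^ (1 + 1 / (c : ℝ)) := by gcongr
    _ = (2 * (c + 3)) ^ (1 + 1 / (c : ℝ)) * a ^ (1 + 1 / (c : ℝ)) :=
        Real.mul_rpow (by positivity) ha
    _ ≤ (4 * (c + 1)) ^ (2 : ℝ) * a ^ (1 + 1 / (c : ℝ)) := by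
        gcongr ?_ * _
        exact (Real.rpow_le_rpow_of_exponent_le (by linarith) hexp).trans
          (Real.rpow_le_rpow (by positivity) (by linarith) two_pos.le)
    _ = 16 * ((c + 1) * (c + 1) * a ^ (1 + 1 / (c : ℝ))) := by
        rw [Real.rpow_two]
        ring
    _ ≤ 16 * ((c + 1)! * 2 ^ c * a ^ (1 + 1 / (c : ℝ))) := by
        gcongr
        exact natCast_succ_le_factorial_succ c

lemma div_le_factorial_mul_rpow_add {c : ℕ} (hc : 1 ≤ c) {A a p q : ℝ} (ha : 0 ≤ a)
    (hA : A ≤ 2 * (c + 3) * a) (hp : 0 < p) (hq : p / 2 ≤ q) :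
    A / q ≤ 8 * ((c + 1)! * (a ^ (1 + 1 / (c : ℝ)) + 1 / p ^ (c + 1))) := by
  have hc1 : (1 : ℝ) ≤ c := by exact_mod_cast hc
  calc A / q ≤ (2 * (c + 3) * a) / (p / 2) := by gcongr
    _ = 4 * (c + 3) * (a * p⁻¹) := by
        field_simp
        ring
    _ ≤ 8 * (c + 1)! * (a ^ (1 + 1 / (c : ℝ)) + p⁻¹ ^ (c + 1)) := by
        gcongr ?_ * ?_
        · linarith [natCast_succ_le_factorial_succ c]
        · exact mul_le_rpow_add_pow (by omega) ha (inv_nonneg.2 hp.le)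
    _ = 8 * ((c + 1)! * (a ^ (1 + 1 / (c : ℝ)) + 1 / p ^ (c + 1))) := by
        rw [inv_pow, one_div (p ^ (c + 1)), mul_assoc]

lemma cost_bound {c N : ℕ} (hc : 1 ≤ c) {A a p q : ℝ} (ha : 0 ≤ a) (hA0 : 0 ≤ A)
    (hA : A ≤ 2 * (c + 3) * a) (hN : (N : ℝ) ^ c ≤ A) (hp : 0 < p) (hpq : p / 2 ≤ q)
    (hpow : p ^ (c + 1) / 2 ≤ q ^ (c + 1)) :
    25 * (N * A) + 25 * 2 ^ c * (A / q) + 25 * 2 ^ c * (c ! / q ^ (c + 1)) ≤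
    600 * ((c + 1)! * 2 ^ c * a ^ (1 + 1 / (c : ℝ)) + 2 ^ c * (c + 1)! / p ^ (c + 1)) := by
  have hfactorial : c ! / q ^ (c + 1) ≤ 2 * ((c + 1)! / p ^ (c + 1)) :=
    calc c ! / q ^ (c + 1) ≤ (c + 1)! / (p ^ (c + 1) / 2) := by
          gcongr
          exact Nat.le_succ c
      _ = 2 * ((c + 1)! / p ^ (c + 1)) := by field_simp
  calc 25 * (N * A) + 25 * 2 ^ c * (A / q) + 25 * 2 ^ c * (c ! / q ^ (c + 1))
      ≤ 25 * (16 * ((c + 1)! * 2 ^ c * a ^ (1 + 1 / (c : ℝ)))) +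
        25 * 2 ^ c * (8 * ((c + 1)! * (a ^ (1 + 1 / (c : ℝ)) + 1 / p ^ (c + 1)))) +
        25 * 2 ^ c * (2 * ((c + 1)! / p ^ (c + 1))) := by
        gcongr 25 * ?_ + 25 * 2 ^ c * ?_ + 25 * 2 ^ c * ?_
        · exact natCast_mul_le_factorial_mul_rpow hc hA0 ha hA hN
        · exact div_le_factorial_mul_rpow_add hc ha hA hp hpq
    _ = 600 * ((c + 1)! * 2 ^ c * a ^ (1 + 1 / (c : ℝ))) +
        250 * (2 ^ c * (c + 1)! / p ^ (c + 1)) := by ring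
    _ ≤ _ := by
        have hgood : 0 ≤ 2 ^ c * (c + 1)! / p ^ (c + 1) := by positivity
        linarith

end Estimates

section PolynomialPhases

variable {k : ℕ} {S : Type*} [Finite S] [MeasurableSpace S] [DiscreteMeasurableSpace S]
  (M : POMC S (Set (Marker k))) (v : ℕ)

lemma window_le : (M.window v : ℝ) ≤ 2 * ((M.Rm v : ℝ) / (M.Pm v).toReal) := by
  have hP : 0 < (M.Pm v).toReal := ENNReal.toReal_pos (M.Pm_pos v).ne'
    (ne_top_of_le_ne_top ENNReal.one_ne_top (M.Pm_le_one v))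
  have hP1 : (M.Pm v).toReal ≤ 1 := ENNReal.toReal_le_of_le_ofReal one_pos.le
    (by simpa using M.Pm_le_one v)
  have hceil := Nat.ceil_lt_add_one (inv_nonneg.2 hP.le)
  rw [window, Nat.cast_mul, div_eq_mul_inv, mul_left_comm]
  gcongr
  linarith [(one_le_inv₀ hP).2 hP1]

lemma phaseCost_pow_le {c n : ℕ} (hn : 1 ≤ n) :
    M.phaseCost (n ^ c) ≤
      ENNReal.ofReal (4 * (n : ℝ) ^ c + 21 * (((c + 3) * M.window v : ℕ) : ℝ)) := by
  refine (M.phaseCost_le v (Nat.pow_pos hn)).trans ?_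
  rw [← ENNReal.ofReal_natCast]
  refine ENNReal.ofReal_le_ofReal ?_
  have : M.window v ≤ (c + 3) * M.window v := Nat.le_mul_of_pos_left _ (by omega)
  exact_mod_cast (by omega : 4 * n ^ c + 21 * M.window v ≤ 4 * n ^ c + 21 * ((c + 3) * M.window v))

lemma restartProb_pow_le {c n : ℕ} (hc : 1 ≤ c)
    (hn : Nat.nthRoot c ((c + 3) * M.window v) < n) :
    M.restartProb (n ^ c) 0 ≤
      ENNReal.ofReal (1 - M.Pgood.toReal * (1 - 3 * 2⁻¹ ^ (c + 3))) :=
  (ENNReal.ofReal_toReal (ne_top_of_le_ne_top ENNReal.one_ne_top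
    (M.restartProb_le_one _ _))).ge.trans (ENNReal.ofReal_le_ofReal
    (M.restartProb_zero_toReal_le v (by omega) ((Nat.nthRoot_lt_iff (by omega)).1 hn).le))

lemma expectedSteps_pow_le_totalCost (c : ℕ) :
    M.expectedSteps (fun n => n ^ c) ≤
      totalCost (fun n => M.phaseCost (n ^ c)) (fun n => M.restartProb (n ^ c) 0) 1 :=
  expectedSteps_le (f := fun n => n ^ c) (Val := totalCost _ _) M fun n _ => (totalCost_eq _ _ n).ge

end PolynomialPhases

end POMC

theorem mainTheorem3_general {c : ℕ} (hc : 1 ≤ c) {k : ℕ} {S : Type*} [Finite S]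
    [MeasurableSpace S] [DiscreteMeasurableSpace S] (M : POMC S (Set (Marker k))) (v : ℕ)
    (hgood : 0 < M.Pgood) :
    M.expectedSteps (fun n => n ^ c) ≤ ENNReal.ofReal (600 *
      ((c + 1)! * 2 ^ c * ((M.Rm v : ℝ) / (M.Pm v).toReal) ^ (1 + 1 / (c : ℝ))
        + 2 ^ c * (c + 1)! / M.Pgood.toReal ^ (c + 1))) := by
  set A : ℕ := (c + 3) * M.window v
  set p : ℝ := M.Pgood.toReal
  set r : ℝ := 1 - 3 * 2⁻¹ ^ (c + 3)
  have hp : 0 < p := ENNReal.toReal_pos hgood.ne' (measure_ne_top _ _)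
  have hp1 : p ≤ 1 := measureReal_le_one
  have hrpow : 1 / 2 ≤ r ^ (c + 1) := POMC.half_le_one_sub_pow c
  have hr1 : r ≤ 1 := sub_le_self 1 (by positivity)
  have hr : 1 / 2 ≤ r := POMC.half_le_one_sub c
  have hAle : (A : ℝ) ≤ 2 * (c + 3) * (M.Rm v / (M.Pm v).toReal) := by
    rw [Nat.cast_mul, Nat.cast_add, Nat.cast_ofNat, mul_comm 2, mul_assoc]
    exact mul_le_mul_of_nonneg_left (M.window_le v) (by positivity)
  have hroot : ((Nat.nthRoot c A : ℕ) : ℝ) ^ c ≤ A := by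
    exact_mod_cast Nat.pow_nthRoot_le (.inl (by omega))
  calc M.expectedSteps (fun n => n ^ c)
      ≤ POMC.totalCost (fun n => M.phaseCost (n ^ c)) (fun n => M.restartProb (n ^ c) 0) 1 :=
        M.expectedSteps_pow_le_totalCost c
    _ ≤ _ := POMC.totalCost_le (x := 1 - p * r) (by nlinarith) (by nlinarith) A.cast_nonneg hroot
        (fun n => M.phaseCost_pow_le v) (fun n => M.restartProb_le_one _ _)
        fun n => M.restartProb_pow_le v hc
    _ ≤ _ := ENNReal.ofReal_le_ofReal (by
        rw [sub_sub_cancel]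
        refine POMC.cost_bound hc (by positivity) A.cast_nonneg hAle hroot hp (by nlinarith) ?_
        rw [mul_pow, div_eq_mul_one_div]
        gcongr)

theorem mainTheorem3 :
    ∃ K : ℝ, ∀ (c : ℕ), 1 ≤ c → ∀ (k : ℕ) (S : Type*) [Fintype S] [MeasurableSpace S]
      [DiscreteMeasurableSpace S] (M : POMC S (Set (Marker k))) (v : ℕ), v ≤ 1 → 0 < M.Pgood →
      M.expectedSteps (fun n => n ^ c) ≤ ENNReal.ofReal (K *
        ((c + 1)! * 2 ^ c * ((M.Rm v : ℝ) / (M.Pm v).toReal) ^ (1 + 1 / (c : ℝ))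
          + 2 ^ c * (c + 1)! / M.Pgood.toReal ^ (c + 1)
          + (c + 1)! * (2 * c) ^ (c + 1))) :=
  ⟨600, fun _ hc _ _ _ _ _ M v _ hgood => (mainTheorem3_general hc M v hgood).trans
    (ENNReal.ofReal_le_ofReal (mul_le_mul_of_nonneg_left (le_add_of_nonneg_right (by positivity))
      (by norm_num)))⟩
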